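/- Let $N\ge 2$ be even and consider the transverse-field XY chain on $N$ spins with periodic boundary conditions, $$H(\gamma,g)=-\sum_{i=1}^N\Big(\tfrac{1+\gamma}{2}\sigma_i^x\sigma_{i+1}^x+\tfrac{1-\gamma}{2}\sigma_i^y\sigma_{i+1}^y\Big)-g\sum_{i=1}^N\sigma_i^z ,\qquad \sigma^\alpha_{N+1}=\sigma^\alpha_1 ,$$ with parity operator $P=\prod_{i=1}^N\sigma_i^z$. For real parameters $(\beta,g,\gamma)$ let $\tilde\rho=e^{-\beta H(\gamma,g)}$ and $\rho_{\rm Gibbs}=\tilde\rho/\mathrm{Tr}\,\tilde\rho$. Let $\rho$ and $\sigma$ be given by arbitrary real parameters $(\beta^\rho,g^\rho,\gamma^\rho)$ and $(\beta^\sigma,g^\sigma,\gamma^\sigma)$. For positive semidefinite $A,B$ let $F(A,B)=\mathrm{Tr}\sqrt{\sqrt A\,B\sqrt A}$ and let $F^{\pm}(A,B)=\mathrm{Tr}\big(\tfrac{1\pm P}{2}\sqrt{\sqrt A\,B\sqrt A}\big)$ be the contributions of the parity sectors $P=\pm1$. Put $\mathbf k^+=\{\frac{\pi}{N},\frac{3\pi}{N},\dots,\pi-\frac{\pi}{N}\}$,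 $\mathbf k^-=\{\frac{2\pi}{N},\frac{4\pi}{N},\dots,\pi-\frac{2\pi}{N}\}$ (empty for $N=2$), $\mathbf K^+=\mathbf k^+\cup(-\mathbf k^+)$, $\mathbf K^-=\mathbf k^-\cup(-\mathbf k^-)\cup\{0,\pi\}$. Let $\epsilon_k(\gamma,g)=\sqrt{(g-\cos k)^2+(\gamma\sin k)^2}$ for $k\ne0,\pi$, and $\epsilon_0=g-1$, $\epsilon_\pi=g+1$. For $k\in\mathbf k^+\cup\mathbf k^-$ let $\vartheta_k$ be any angle with $\epsilon_k\sin\vartheta_k=\gamma\sin k$ and $\epsilon_k\cos\vartheta_k=g-\cos k$ (so $\vartheta_k$ is determined modulo $2\pi$ if $\epsilon_k\neq0$, and is arbitrary if $\epsilon_k=0$). Superscripts $\rho,\sigma$ on $\epsilon_k,\vartheta_k$ indicate the parameters at which they are taken. Put $$u_k=2\cosh\big(\beta^\rho\epsilon_k^\rho+\beta^\sigma\epsilon_k^\sigma\big)\cos\Big(\frac{\vartheta_k^\rho-\vartheta_k^\sigma}{2}\Big),\qquad v_k=2\cosh\big(\beta^\rho\epsilon_k^\rho-\beta^\sigma\epsilon_k^\sigma\big)\sin\Big(\frac{\vartheta_k^\rho-\vartheta_k^\sigma}{2}\Big),$$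 $$Z(\beta,g,\gamma)=\frac12\Big[\prod_{k\in\mathbf K^+}2\cosh(\beta\epsilon_k)+\prod_{k\in\mathbf K^+}2\sinh(\beta\epsilon_k)+\prod_{k\in\mathbf K^-}2\cosh(\beta\epsilon_k)-\prod_{k\in\mathbf K^-}2\sinh(\beta\epsilon_k)\Big].$$ Then $Z(\beta,g,\gamma)=\mathrm{Tr}\,e^{-\beta H(\gamma,g)}>0$ for both parameter triples, and $$F(\rho_{\rm Gibbs},\sigma_{\rm Gibbs})=\frac{F^+(\tilde\rho,\tilde\sigma)+F^-(\tilde\rho,\tilde\sigma)}{\sqrt{Z(\beta^\rho,g^\rho,\gamma^\rho)\,Z(\beta^\sigma,g^\sigma,\gamma^\sigma)}},$$ where $$F^+(\tilde\rho,\tilde\sigma)=\frac12\Big[\prod_{k\in\mathbf k^+}\Big(\sqrt{u_k^2+v_k^2}+2\Big)+\prod_{k\in\mathbf k^+}\Big(\sqrt{u_k^2+v_k^2}-2\Big)\Big],$$ $$\begin{aligned}F^-(\tilde\rho,\tilde\sigma)=\frac12\Big[&4\cosh\Big(\frac{\beta^\rho\epsilon_0^\rho+\beta^\sigma\epsilon_0^\sigma}{2}\Big)\cosh\Big(\frac{\beta^\rho\epsilon_\pi^\rho+\beta^\sigma\epsilon_\pi^\sigma}{2}\Big)\prod_{k\in\mathbf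 k^-}\Big(\sqrt{u_k^2+v_k^2}+2\Big)\\&-4\sinh\Big(\frac{\beta^\rho\epsilon_0^\rho+\beta^\sigma\epsilon_0^\sigma}{2}\Big)\sinh\Big(\frac{\beta^\rho\epsilon_\pi^\rho+\beta^\sigma\epsilon_\pi^\sigma}{2}\Big)\prod_{k\in\mathbf k^-}\Big(\sqrt{u_k^2+v_k^2}-2\Big)\Big].\end{aligned}$$ -/

import Mathlib

namespace XYChain

/-! ## The spin chain -/

/-- A spin-1/2 configuration of `N` sites; `0` is the eigenvalue `+1` of the third Pauli matrix and
`1` is the eigenvalue `-1`. -/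
abbrev Config (N : ℕ) : Type := Fin N → Fin 2

/-- Operators on the Hilbert space of `N` spins, as matrices in the configuration basis. -/
abbrev Op (N : ℕ) : Type := Matrix (Config N) (Config N) ℂ

/-- The Pauli matrix `σ^x`. -/
def pauliX : Matrix (Fin 2) (Fin 2) ℂ := !![0, 1; 1, 0]

/-- The Pauli matrix `σ^y`. -/
def pauliY : Matrix (Fin 2) (Fin 2) ℂ := !![0, -Complex.I; Complex.I, 0]

/-- The Pauli matrix `σ^z`. -/
def pauliZ : Matrix (Fin 2) (Fin 2) ℂ := !![1, 0; 0, -1]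

/-- The one-site operator `A` acting on site `i`, i.e. `1 ⊗ ⋯ ⊗ A ⊗ ⋯ ⊗ 1`. -/
def site {N : ℕ} (A : Matrix (Fin 2) (Fin 2) ℂ) (i : Fin N) : Op N :=
  Matrix.of fun s t => if ∀ j, j ≠ i → s j = t j then A (s i) (t i) else 0

/-- The Hamiltonian `H(γ, g)` of the XY chain in a transverse field. Addition in `Fin N` is modulo
`N`, so that the boundary conditions are periodic. -/
noncomputable def hamiltonian (N : ℕ) [NeZero N] (γ g : ℝ) : Op N :=
  -(∑ i : Fin N,
      ((((1 + γ) / 2 : ℝ) : ℂ) • (site pauliX i * site pauliX (i + 1))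
        + (((1 - γ) / 2 : ℝ) : ℂ) • (site pauliY i * site pauliY (i + 1))))
    - (g : ℂ) • ∑ i : Fin N, site pauliZ i

/-- The parity operator `P = σ^z_1 σ^z_2 ⋯ σ^z_N`. -/
def parity (N : ℕ) : Op N := (List.ofFn fun i : Fin N => site pauliZ i).prod

/-- The parameters of a thermal state: inverse temperature, field and anisotropy. -/
structure Params where
  /-- inverse temperature -/
  β : ℝ
  /-- transverse field -/
  g : ℝ
  /-- anisotropy -/
  γ : ℝ

/-- The unnormalized Gibbs state `exp (-β H(γ, g))`. -/
noncomputable def gibbsWeight (N : ℕ) [NeZero N] (p : Params) : Op N :=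
  NormedSpace.exp (-((p.β : ℂ) • hamiltonian N p.γ p.g))

/-- The Gibbs state `exp (-β H(γ, g)) / Tr exp (-β H(γ, g))`. -/
noncomputable def gibbsState (N : ℕ) [NeZero N] (p : Params) : Op N :=
  (gibbsWeight N p).trace⁻¹ • gibbsWeight N p

/-! ## Uhlmann fidelity -/

section Sqrt

open scoped MatrixOrder ComplexOrder

/-- The positive semidefinite square root of a positive semidefinite matrix. -/
noncomputable def msqrt {N : ℕ} (A : Op N) : Op N := CFC.sqrt A

end Sqrt

/-- The operator `√(√ρ σ √ρ)`, for positive semidefinite `ρ` and `σ`. -/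
noncomputable def fidelityOp {N : ℕ} (ρ σ : Op N) : Op N :=
  msqrt (msqrt ρ * σ * msqrt ρ)

/-- The Uhlmann fidelity `Tr √(√ρ σ √ρ)`. -/
noncomputable def fidelity {N : ℕ} (ρ σ : Op N) : ℂ := (fidelityOp ρ σ).trace

/-- The contribution of the sector `P = 1` to `Tr √(√ρ σ √ρ)`. -/
noncomputable def fidelityPlus {N : ℕ} (ρ σ : Op N) : ℂ :=
  (((1 / 2 : ℂ) • (1 + parity N)) * fidelityOp ρ σ).trace

/-- The contribution of the sector `P = -1` to `Tr √(√ρ σ √ρ)`. -/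
noncomputable def fidelityMinus {N : ℕ} (ρ σ : Op N) : ℂ :=
  (((1 / 2 : ℂ) • (1 - parity N)) * fidelityOp ρ σ).trace

/-! ## Momenta, Bogoliubov energies and angles -/

/-- `𝐤⁺ = {π/N, 3π/N, …, π - π/N}` (for even `N`). -/
noncomputable def kPlus (N : ℕ) : Finset ℝ :=
  (Finset.range (N / 2)).image fun j : ℕ => (2 * (j : ℝ) + 1) * Real.pi / N

/-- `𝐤⁻ = {2π/N, 4π/N, …, π - 2π/N}` (for even `N`). -/
noncomputable def kMinus (N : ℕ) : Finset ℝ :=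
  (Finset.Ico 1 (N / 2)).image fun j : ℕ => 2 * (j : ℝ) * Real.pi / N

/-- `𝐊⁺ = 𝐤⁺ ∪ -𝐤⁺`. -/
noncomputable def KPlus (N : ℕ) : Finset ℝ := kPlus N ∪ (kPlus N).image fun k => -k

/-- `𝐊⁻ = 𝐤⁻ ∪ -𝐤⁻ ∪ {0, π}`. -/
noncomputable def KMinus (N : ℕ) : Finset ℝ :=
  kMinus N ∪ ((kMinus N).image fun k => -k) ∪ {0, Real.pi}

/-- The Bogoliubov energies `ε_k(γ, g)`, with the signed values `ε_0 = g - 1`, `ε_π = g + 1` of the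
two special modes. -/
noncomputable def energy (γ g k : ℝ) : ℝ :=
  if k = 0 then g - 1
  else if k = Real.pi then g + 1
  else √((g - Real.cos k) ^ 2 + (γ * Real.sin k) ^ 2)

/-- `ϑ` is a Bogoliubov angle of the mode `k`: `(sin ϑ, cos ϑ) = (γ sin k, g - cos k) / ε_k`. It is
written without the division, so that any `ϑ` is admitted if `ε_k = 0`. -/
def IsBogoliubovAngle (γ g k ϑ : ℝ) : Prop :=
  energy γ g k * Real.sin ϑ = γ * Real.sin k ∧
    energy γ g k * Real.cos ϑ = g - Real.cos k

/-! ## The explicit expressions -/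

/-- The exact partition function `Z(β, γ, g)`. -/
noncomputable def partitionZ (N : ℕ) (p : Params) : ℝ :=
  1 / 2 *
    (∏ k ∈ KPlus N, 2 * Real.cosh (p.β * energy p.γ p.g k)
      + ∏ k ∈ KPlus N, 2 * Real.sinh (p.β * energy p.γ p.g k)
      + ∏ k ∈ KMinus N, 2 * Real.cosh (p.β * energy p.γ p.g k)
      - ∏ k ∈ KMinus N, 2 * Real.sinh (p.β * energy p.γ p.g k))

/-- `u_k(ρ|σ)`; `θ` and `η` are the Bogoliubov angles of the two states. -/
noncomputable def u (p q : Params) (θ η : ℝ → ℝ) (k : ℝ) : ℝ :=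
  2 * Real.cosh (p.β * energy p.γ p.g k + q.β * energy q.γ q.g k) * Real.cos ((θ k - η k) / 2)

/-- `v_k(ρ|σ)`; `θ` and `η` are the Bogoliubov angles of the two states. -/
noncomputable def v (p q : Params) (θ η : ℝ → ℝ) (k : ℝ) : ℝ :=
  2 * Real.cosh (p.β * energy p.γ p.g k - q.β * energy q.γ q.g k) * Real.sin ((θ k - η k) / 2)

/-- The explicit expression for the positive-parity part. -/
noncomputable def explicitPlus (N : ℕ) (p q : Params) (θ η : ℝ → ℝ) : ℝ :=
  1 / 2 *
    (∏ k ∈ kPlus N, (√(u p q θ η k ^ 2 + v p q θ η k ^ 2) + 2)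
      + ∏ k ∈ kPlus N, (√(u p q θ η k ^ 2 + v p q θ η k ^ 2) - 2))

/-- The explicit expression for the negative-parity part. -/
noncomputable def explicitMinus (N : ℕ) (p q : Params) (θ η : ℝ → ℝ) : ℝ :=
  1 / 2 *
    (4 * Real.cosh ((p.β * energy p.γ p.g 0 + q.β * energy q.γ q.g 0) / 2)
        * Real.cosh ((p.β * energy p.γ p.g Real.pi + q.β * energy q.γ q.g Real.pi) / 2)
        * ∏ k ∈ kMinus N, (√(u p q θ η k ^ 2 + v p q θ η k ^ 2) + 2)
      - 4 * Real.sinh ((p.β * energy p.γ p.g 0 + q.β * energy q.γ q.g 0) / 2)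
        * Real.sinh ((p.β * energy p.γ p.g Real.pi + q.β * energy q.γ q.g Real.pi) / 2)
        * ∏ k ∈ kMinus N, (√(u p q θ η k ^ 2 + v p q θ η k ^ 2) - 2))

end XYChain

namespace XYChain

open Matrix

/-! ## Pauli algebra and tensor products -/

/-! The Jordan–Wigner transformation turns every term of the Hamiltonian into a product of two
Majorana operators, except that the closing bond acquires a factor of the parity `P`. On each
eigenspace of `P` that factor is a sign, so there `H` agrees with a quadratic form with antiperiodic
(`P = 1`, twist exponent `δ = 1`) or periodic (`P = -1`, `δ = 0`) boundary condition
(`hamiltonian_mul_sectorProj`).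

The real orthogonal Hartley transform then gives Majorana modes that are still Hermitian, and
couples only the momenta `k` and `2π - k`. Such a pair carries a pseudo-spin: operators `Z`, `X`
that vanish on odd local parity and act as Pauli matrices on even local parity. Its Hamiltonian is
`-2ε (cos ϑ Z - sin ϑ X)` (`modeH_pair`). The fidelity of one pair is thus a computation with 2×2
matrices: the product `exp(a w) exp(2b w') exp(a w)` has even-parity part `T + W` with `W² = T² -
1`, and writing `T = cosh x`, its square root has even-parity trace `r = 2 cosh(x/2) = √(u² + v²)`.
The two odd states contribute `2`, or `-2` when weighted with the local parity (`exists_mode_sqrt`,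
`IsMajorana.exists_pairBlock`). The momenta `0` and `π` are single modes, where the two exponents
commute.

Even elements supported on different momentum blocks commute, so exponentials and square roots
factor over blocks, and so do traces (`Block.exp_sandwich`, `Block.trace_prod`). The product of the
local parities is `P` (`prodP_eq_parity`), seen by exponentiating the total magnetization in
position and in momentum space. Gluing the two sector roots with the projections `(1 ± P)/2` gives a
positive semidefinite square root (`exists_fidelityOp`), which is the fidelity operator by
uniqueness; positivity holds because each local root is itself the square of a Hermitian element.

The partition function is the case `ρ = σ`, where the fidelity operator of a positive matrix with
itself is that matrix (`trace_gibbsWeight`). -/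

theorem pauliX_mul_self : pauliX * pauliX = 1 := by
  ext i j; fin_cases i <;> fin_cases j <;> simp [pauliX]

theorem pauliY_mul_self : pauliY * pauliY = 1 := by
  ext i j; fin_cases i <;> fin_cases j <;> simp [pauliY]

theorem pauliZ_mul_self : pauliZ * pauliZ = 1 := by
  ext i j; fin_cases i <;> fin_cases j <;> simp [pauliZ]

theorem pauliX_mul_pauliY : pauliX * pauliY = Complex.I • pauliZ := by
  ext i j; fin_cases i <;> fin_cases j <;> simp [pauliX, pauliY, pauliZ]

theorem pauliY_mul_pauliX : pauliY * pauliX = (-Complex.I) • pauliZ := by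
  ext i j; fin_cases i <;> fin_cases j <;> simp [pauliX, pauliY, pauliZ]

theorem pauliY_mul_pauliZ : pauliY * pauliZ = Complex.I • pauliX := by
  ext i j; fin_cases i <;> fin_cases j <;> simp [pauliX, pauliY, pauliZ]

theorem pauliZ_mul_pauliY : pauliZ * pauliY = (-Complex.I) • pauliX := by
  ext i j; fin_cases i <;> fin_cases j <;> simp [pauliX, pauliY, pauliZ]

theorem pauliZ_mul_pauliX : pauliZ * pauliX = Complex.I • pauliY := by
  ext i j; fin_cases i <;> fin_cases j <;> simp [pauliX, pauliY, pauliZ]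

theorem pauliX_mul_pauliZ : pauliX * pauliZ = (-Complex.I) • pauliY := by
  ext i j; fin_cases i <;> fin_cases j <;> simp [pauliX, pauliY, pauliZ]

theorem pauliX_isHermitian : pauliX.IsHermitian := by
  ext i j; fin_cases i <;> fin_cases j <;> simp [pauliX]

theorem pauliY_isHermitian : pauliY.IsHermitian := by
  ext i j; fin_cases i <;> fin_cases j <;> simp [pauliY]

theorem pauliZ_isHermitian : pauliZ.IsHermitian := by
  ext i j; fin_cases i <;> fin_cases j <;> simp [pauliZ]

section JordanWigner

variable {N : ℕ}

/-- The tensor product of one-site operators. -/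
def tens (f : Fin N → Matrix (Fin 2) (Fin 2) ℂ) : Op N :=
  Matrix.of fun s t => ∏ j, f j (s j) (t j)

theorem tens_mul (f g : Fin N → Matrix (Fin 2) (Fin 2) ℂ) :
    tens f * tens g = tens fun j => f j * g j := by
  ext s t
  simp only [tens, Matrix.mul_apply, Matrix.of_apply, Finset.prod_univ_sum,
    Fintype.piFinset_univ, Finset.prod_mul_distrib]

theorem tens_one : tens (fun _ : Fin N => 1) = 1 := by
  ext s t
  by_cases h : s = t
  · subst h; simp [tens, Matrix.one_apply_eq]
  · obtain ⟨j, hj⟩ := Function.ne_iff.mp h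
    simp only [tens, Matrix.of_apply, Matrix.one_apply_ne h]
    exact Finset.prod_eq_zero (Finset.mem_univ j) (Matrix.one_apply_ne hj)

theorem tens_isHermitian {f : Fin N → Matrix (Fin 2) (Fin 2) ℂ} (hf : ∀ j, (f j).IsHermitian) :
    (tens f).IsHermitian := by
  ext s t
  simp only [tens, Matrix.conjTranspose_apply, Matrix.of_apply, star_prod]
  exact Finset.prod_congr rfl fun j _ => (hf j).apply _ _

/-- This localizes signs: in each Jordan–Wigner identity below, the two string products differ at
one site only, and the scalar is read off there. -/
theorem tens_eq_smul {f g : Fin N → Matrix (Fin 2) (Fin 2) ℂ} (i : Fin N) (c : ℂ)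
    (hi : f i = c • g i) (h : ∀ j, j ≠ i → f j = g j) : tens f = c • tens g := by
  ext s t
  simp only [tens, Matrix.smul_apply, Matrix.of_apply, smul_eq_mul]
  rw [← Finset.mul_prod_erase _ _ (Finset.mem_univ i),
    ← Finset.mul_prod_erase (f := fun j => g j (s j) (t j)) _ (Finset.mem_univ i), hi,
    Matrix.smul_apply, smul_eq_mul, mul_assoc]
  congr 2
  exact Finset.prod_congr rfl fun j hj => by rw [h j (Finset.ne_of_mem_erase hj)]

theorem site_eq_tens (A : Matrix (Fin 2) (Fin 2) ℂ) (i : Fin N) :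
    site A i = tens fun j => if j = i then A else 1 := by
  ext s t
  simp only [site, tens, Matrix.of_apply]
  split_ifs with h
  · rw [Finset.prod_eq_single i]
    · simp
    · intro j _ hj
      rw [if_neg hj, h j hj, Matrix.one_apply_eq]
    · simp
  · push Not at h
    obtain ⟨j, hj, hne⟩ := h
    exact (Finset.prod_eq_zero (Finset.mem_univ j) (by simp [hj, hne])).symm

theorem site_isHermitian {A : Matrix (Fin 2) (Fin 2) ℂ} (hA : A.IsHermitian) (i : Fin N) :
    (site A i).IsHermitian := by
  rw [site_eq_tens]
  refine tens_isHermitian fun j => ?_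
  split_ifs
  exacts [hA, Matrix.isHermitian_one]

theorem site_mul_site_same (A B : Matrix (Fin 2) (Fin 2) ℂ) (i : Fin N) :
    site A i * site B i = site (A * B) i := by
  rw [site_eq_tens, site_eq_tens, site_eq_tens, tens_mul]
  congr 1; funext j; split_ifs <;> simp

theorem site_commute (A B : Matrix (Fin 2) (Fin 2) ℂ) {i j : Fin N} (h : i ≠ j) :
    Commute (site A i) (site B j) := by
  rw [Commute, SemiconjBy, site_eq_tens, site_eq_tens, tens_mul, tens_mul]
  congr 1; funext l
  by_cases h1 : l = i
  · subst h1; simp [h]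
  · simp [h1]

theorem prod_ofFn_tens {n : ℕ} (f : Fin n → Fin N → Matrix (Fin 2) (Fin 2) ℂ) :
    (List.ofFn fun i => tens (f i)).prod = tens fun j => (List.ofFn fun i => f i j).prod := by
  induction n with
  | zero => simp [tens_one]
  | succ n ih => simp only [List.ofFn_succ, List.prod_cons, ih, tens_mul]

theorem prod_ofFn_ite {M : Type*} [Monoid M] {n : ℕ} (x : M) (j : Fin n) :
    (List.ofFn fun i : Fin n => if j = i then x else 1).prod = x := by
  induction n with
  | zero => exact j.elim0
  | succ n ih =>
    refine Fin.cases ?_ (fun j => ?_) j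
    · simp [List.ofFn_succ, (Fin.succ_ne_zero _).symm]
    · simpa [List.ofFn_succ, Fin.succ_ne_zero] using ih j

theorem parity_eq_tens : parity N = tens fun _ => pauliZ := by
  simp only [parity, site_eq_tens, prod_ofFn_tens, prod_ofFn_ite]

theorem parity_isHermitian : (parity N).IsHermitian := by
  rw [parity_eq_tens]; exact tens_isHermitian fun _ => pauliZ_isHermitian

theorem parity_mul_self : parity N * parity N = 1 := by
  simp only [parity_eq_tens, tens_mul, pauliZ_mul_self, tens_one]

/-! ## Jordan–Wigner Majorana operators -/

/-- The Pauli matrix at the end of a Jordan–Wigner string. -/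
def endPauli : Bool → Matrix (Fin 2) (Fin 2) ℂ
  | false => pauliX
  | true => pauliY

/-- The Jordan–Wigner Majorana operators; `maj false j` ends in `σ^x` and `maj true j` in `σ^y`. -/
def maj (b : Bool) (j : Fin N) : Op N :=
  tens fun l => if l < j then pauliZ else if l = j then endPauli b else 1

theorem endPauli_mul_self (b : Bool) : endPauli b * endPauli b = 1 := by
  cases b
  exacts [pauliX_mul_self, pauliY_mul_self]

theorem endPauli_isHermitian (b : Bool) : (endPauli b).IsHermitian := by
  cases b
  exacts [pauliX_isHermitian, pauliY_isHermitian]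

theorem pauliZ_mul_endPauli (b : Bool) : pauliZ * endPauli b = -(endPauli b * pauliZ) := by
  cases b <;>
    simp [endPauli, pauliZ_mul_pauliX, pauliX_mul_pauliZ, pauliZ_mul_pauliY, pauliY_mul_pauliZ]

theorem maj_isHermitian (b : Bool) (j : Fin N) : (maj b j).IsHermitian := by
  refine tens_isHermitian fun l => ?_
  split_ifs
  exacts [pauliZ_isHermitian, endPauli_isHermitian b, Matrix.isHermitian_one]

theorem maj_mul_self (b : Bool) (j : Fin N) : maj b j * maj b j = 1 := by
  rw [maj, tens_mul, ← tens_one]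
  congr 1; funext l; split_ifs <;> simp [pauliZ_mul_self, endPauli_mul_self]

theorem maj_anticomm_of_lt (b c : Bool) {i j : Fin N} (h : i < j) :
    maj b i * maj c j = -(maj c j * maj b i) := by
  rw [maj, maj, tens_mul, tens_mul, ← neg_one_smul ℂ]
  refine tens_eq_smul i _ ?_ fun l hl => ?_
  · simp [h, pauliZ_mul_endPauli]
  · by_cases h1 : l < i
    · simp [h1, h1.trans h]
    · simp [h1, hl]

theorem maj_anticomm_same (j : Fin N) :
    maj false j * maj true j = -(maj true j * maj false j) := by
  rw [maj, maj, tens_mul, tens_mul, ← neg_one_smul ℂ]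
  refine tens_eq_smul j _ ?_ fun l hl => ?_
  · simp [endPauli, pauliX_mul_pauliY, pauliY_mul_pauliX]
  · simp [hl]

theorem maj_anticomm {x y : Bool × Fin N} (h : x ≠ y) :
    maj x.1 x.2 * maj y.1 y.2 = -(maj y.1 y.2 * maj x.1 x.2) := by
  obtain ⟨b, i⟩ := x
  obtain ⟨c, j⟩ := y
  rcases lt_trichotomy i j with hij | rfl | hij
  · exact maj_anticomm_of_lt b c hij
  · cases b <;> cases c
    · exact absurd rfl h
    · exact maj_anticomm_same i
    · simp [maj_anticomm_same i]
    · exact absurd rfl h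
  · simp [maj_anticomm_of_lt c b hij]

theorem parity_maj (b : Bool) (j : Fin N) : parity N * maj b j = -(maj b j * parity N) := by
  rw [parity_eq_tens, maj, tens_mul, tens_mul, ← neg_one_smul ℂ]
  refine tens_eq_smul j _ ?_ fun l hl => ?_
  · simp [pauliZ_mul_endPauli]
  · by_cases h1 : l < j <;> simp [h1, hl]

/-! ## The Hamiltonian in terms of Majorana operators -/

theorem site_pauliZ_eq (j : Fin N) :
    site pauliZ j = Complex.I • (maj true j * maj false j) := by
  rw [maj, maj, tens_mul, site_eq_tens]
  refine tens_eq_smul j _ ?_ fun l hl => ?_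
  · simp [endPauli, pauliY_mul_pauliX, smul_smul]
  · by_cases h1 : l < j <;> simp [h1, hl, pauliZ_mul_self]

/-- The factor by which the bond between `j` and `j + 1` differs from the corresponding bilinear
expression in the Majorana operators. -/
def bondSign [NeZero N] (j : Fin N) : Op N := if j.val + 1 = N then -parity N else 1

/-- On an interior bond the two strings cancel up to one `σ^z` at `j`, which the end Pauli absorbs.
On the closing bond the string runs along the whole chain, and multiplying by the parity removes it;
this is the origin of `-P` in `bondSign`. -/
theorem site_pauliX_bond [NeZero N] (hN : 2 ≤ N) (j : Fin N) :
    site pauliX j * site pauliX (j + 1) =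
      (-Complex.I) • (bondSign j * (maj true j * maj false (j + 1))) := by
  rw [bondSign]
  split_ifs with h
  · have h1 : j + 1 = 0 := by
      ext; rw [Fin.val_add, Fin.val_one', Nat.add_mod_mod, h, Nat.mod_self]; rfl
    have hj : (0 : Fin N) ≠ j := by
      intro h0; rw [← h0] at h; simp at h; omega
    rw [h1, neg_mul, smul_neg, neg_smul, neg_neg, parity_eq_tens, maj, maj, tens_mul, tens_mul,
      site_eq_tens, site_eq_tens, tens_mul]
    refine tens_eq_smul j _ ?_ fun l hl => ?_
    · simp [hj.symm, endPauli, pauliZ_mul_pauliY, smul_smul]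
    · have hlt : l < j := by
        rw [Fin.lt_def]; have := l.isLt; have : l.val ≠ j.val := fun h => hl (Fin.ext h); omega
      by_cases h0 : l = 0
      · subst h0; simp [hj, hlt, endPauli, ← mul_assoc, pauliZ_mul_self]
      · simp [h0, hl, hlt, pauliZ_mul_self]
  · have hv : (j + 1).val = j.val + 1 := by
      rw [Fin.val_add, Fin.val_one', Nat.add_mod_mod, Nat.mod_eq_of_lt]
      have := j.isLt; omega
    have hj : j < j + 1 := by rw [Fin.lt_def]; omega
    rw [one_mul, maj, maj, tens_mul, site_eq_tens, site_eq_tens, tens_mul]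
    refine tens_eq_smul j _ ?_ fun l hl => ?_
    · simp [hj, hj.ne, endPauli, pauliY_mul_pauliZ, smul_smul]
    · rcases lt_or_gt_of_ne hl with h1 | h1
      · simp [h1, h1.trans hj, hl, (h1.trans hj).ne, pauliZ_mul_self]
      · have h2 : ¬ l < j + 1 := by rw [Fin.lt_def] at h1 ⊢; omega
        simp [h1.not_gt, hl, h2, endPauli]

theorem site_pauliY_bond [NeZero N] (hN : 2 ≤ N) (j : Fin N) :
    site pauliY j * site pauliY (j + 1) =
      (-Complex.I) • (bondSign j * (maj true (j + 1) * maj false j)) := by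
  have hne : j ≠ j + 1 := by
    intro h
    have := congrArg Fin.val h
    rw [Fin.val_add, Fin.val_one', Nat.add_mod_mod] at this
    have hj := j.isLt
    rcases Nat.lt_or_ge (j.val + 1) N with h2 | h2
    · rw [Nat.mod_eq_of_lt h2] at this; omega
    · have : j.val + 1 = N := by omega
      simp_all
  rw [show maj true (j + 1) * maj false j = -(maj false j * maj true (j + 1)) from
    maj_anticomm (x := (true, j + 1)) (y := (false, j)) (by simp), mul_neg, smul_neg, neg_smul,
    neg_neg, bondSign]
  split_ifs with h
  · have h1 : j + 1 = 0 := by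
      ext; rw [Fin.val_add, Fin.val_one', Nat.add_mod_mod, h, Nat.mod_self]; rfl
    have hj : (0 : Fin N) ≠ j := h1 ▸ hne.symm
    rw [h1, neg_mul, smul_neg, ← neg_smul, parity_eq_tens, maj, maj, tens_mul, tens_mul,
      site_eq_tens, site_eq_tens, tens_mul]
    refine tens_eq_smul j _ ?_ fun l hl => ?_
    · simp [hj.symm, endPauli, pauliZ_mul_pauliX, smul_smul]
    · have hlt : l < j := by
        rw [Fin.lt_def]; have := l.isLt; have : l.val ≠ j.val := fun h => hl (Fin.ext h); omega
      by_cases h0 : l = 0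
      · subst h0; simp [hj, hlt, endPauli, ← mul_assoc, pauliZ_mul_self]
      · simp [h0, hl, hlt, pauliZ_mul_self]
  · have hv : (j + 1).val = j.val + 1 := by
      rw [Fin.val_add, Fin.val_one', Nat.add_mod_mod, Nat.mod_eq_of_lt]
      have := j.isLt; omega
    have hj : j < j + 1 := by rw [Fin.lt_def]; omega
    rw [one_mul, maj, maj, tens_mul, site_eq_tens, site_eq_tens, tens_mul]
    refine tens_eq_smul j _ ?_ fun l hl => ?_
    · simp [hj, hj.ne, endPauli, pauliX_mul_pauliZ, smul_smul]
    · rcases lt_or_gt_of_ne hl with h1 | h1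
      · simp [h1, h1.trans hj, hl, (h1.trans hj).ne, pauliZ_mul_self]
      · have h2 : ¬ l < j + 1 := by rw [Fin.lt_def] at h1 ⊢; omega
        simp [h1.not_gt, hl, h2, endPauli]

end JordanWigner

/-! ## Exponentials -/

section Exp

variable {n : Type*} [Fintype n] [DecidableEq n]

/-- All positive powers of `e` equal `e`, so the series is `exp c • e` apart from the zeroth term,
which is `1` instead of `e`. -/
theorem exp_smul_of_idempotent {e : Matrix n n ℂ} (he : e * e = e) (c : ℂ) :
    NormedSpace.exp (c • e) = 1 + (Complex.exp c - 1) • e := by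
  open scoped Matrix.Norms.Operator in
  have h1 := NormedSpace.exp_series_hasSum_exp' (𝕂 := ℂ) (c • e)
  have h2 := (NormedSpace.exp_series_hasSum_exp' (𝕂 := ℂ) c).smul_const e
  have h3 := h2.add (hasSum_ite_eq (0 : ℕ) (1 - e))
  rw [← Complex.exp_eq_exp_ℂ] at h3
  have h4 : (fun k : ℕ => ((k.factorial : ℂ)⁻¹) • (c • e) ^ k) =
      fun k : ℕ => ((k.factorial : ℂ)⁻¹ • c ^ k) • e + if k = 0 then 1 - e else 0 := by
    funext k
    cases k with
    | zero => simp
    | succ k =>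
      have : e ^ (k + 1) = e := IsIdempotentElem.pow_succ_eq k he
      rw [smul_pow, this]
      simp [smul_smul]
  rw [h4] at h1
  refine (h1.unique h3).trans ?_
  module

theorem exp_smul_of_sq_eq_idempotent {Q w : Matrix n n ℂ} (hQ : Q * Q = Q) (hw : w * w = Q)
    (hQw : Q * w = w) (hwQ : w * Q = w) (c : ℂ) :
    NormedSpace.exp (c • w) = 1 - Q + Complex.cosh c • Q + Complex.sinh c • w := by
  have h1 : ((1 / 2 : ℂ) • (Q + w)) * ((1 / 2 : ℂ) • (Q + w)) = (1 / 2 : ℂ) • (Q + w) := by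
    simp only [smul_mul_assoc, mul_smul_comm, mul_add, add_mul, hQ, hw, hQw, hwQ]
    module
  have h2 : ((1 / 2 : ℂ) • (Q - w)) * ((1 / 2 : ℂ) • (Q - w)) = (1 / 2 : ℂ) • (Q - w) := by
    simp only [smul_mul_assoc, mul_smul_comm, mul_sub, sub_mul, hQ, hw, hQw, hwQ]
    module
  have h3 : ((1 / 2 : ℂ) • (Q + w)) * ((1 / 2 : ℂ) • (Q - w)) = 0 := by
    simp only [smul_mul_assoc, mul_smul_comm, mul_sub, add_mul, hQ, hw, hQw, hwQ]
    module
  have h4 : ((1 / 2 : ℂ) • (Q - w)) * ((1 / 2 : ℂ) • (Q + w)) = 0 := by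
    simp only [smul_mul_assoc, mul_smul_comm, mul_add, sub_mul, hQ, hw, hQw, hwQ]
    module
  -- Spectral decomposition of `w`: `(Q ± w)/2` are orthogonal idempotents for the eigenvalues `±1`.
  have hc : c • w = c • ((1 / 2 : ℂ) • (Q + w)) + (-c) • ((1 / 2 : ℂ) • (Q - w)) := by module
  have hcomm : Commute (c • ((1 / 2 : ℂ) • (Q + w))) ((-c) • ((1 / 2 : ℂ) • (Q - w))) := by
    refine Commute.smul_left (Commute.smul_right ?_ _) _
    exact h3.trans h4.symm
  rw [hc, Matrix.exp_add_of_commute _ _ hcomm, exp_smul_of_idempotent h1,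
    exp_smul_of_idempotent h2]
  rw [mul_add, mul_one, add_mul, one_mul, smul_mul_assoc, mul_smul_comm, h3, smul_zero,
    smul_zero, add_zero, Complex.cosh, Complex.sinh]
  module

/-- This transfers the sectorwise identity of the Hamiltonians to their exponentials: since `E`
commutes with `Y`, agreement after multiplication by `E` passes to all powers. -/
theorem exp_mul_eq_of_mul_eq {X Y E : Matrix n n ℂ} (h : X * E = Y * E) (hE : Commute E Y) :
    NormedSpace.exp X * E = NormedSpace.exp Y * E := by
  have hpow : ∀ k : ℕ, X ^ k * E = Y ^ k * E := by
    intro k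
    induction k with
    | zero => simp
    | succ k ih =>
      rw [pow_succ', mul_assoc, ih, ← (hE.pow_right k).eq, ← mul_assoc, h, mul_assoc,
        (hE.pow_right k).eq, ← mul_assoc, ← pow_succ']
  open scoped Matrix.Norms.Operator in
  have h1 := (NormedSpace.exp_series_hasSum_exp' (𝕂 := ℂ) X).mul_right E
  have h2 := (NormedSpace.exp_series_hasSum_exp' (𝕂 := ℂ) Y).mul_right E
  simp only [smul_mul_assoc, hpow] at h1 h2
  exact h1.unique h2

theorem commute_exp_right {X Y : Matrix n n ℂ} (h : Commute X Y) :
    Commute X (NormedSpace.exp Y) := by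
  open scoped Matrix.Norms.Operator in
  exact h.exp_right

theorem commute_exp {X Y : Matrix n n ℂ} (h : Commute X Y) :
    Commute (NormedSpace.exp X) (NormedSpace.exp Y) :=
  commute_exp_right (commute_exp_right h.symm).symm

end Exp

/-! ## Square roots in a single mode -/

section Mode

variable {A : Type*} [Ring A] [Algebra ℂ A]

/-- The operator `1 - Q + T Q + w`. -/
def modeOp (Q : A) (T : ℂ) (w : A) : A := 1 - Q + T • Q + w

/-- The half-argument formula: with `T = cosh x` and `w = sinh x • n`, one has `r = 2 cosh (x/2)`
and `r⁻¹ • w = sinh (x/2) • n`. -/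
theorem modeOp_half_sq {Q w : A} {T r : ℂ} (hr : r ^ 2 = 2 * T + 2) (hr0 : r ≠ 0)
    (hQ : Q * Q = Q) (hQw : Q * w = w) (hwQ : w * Q = w) (hw : w * w = (T ^ 2 - 1) • Q) :
    modeOp Q (r / 2) (r⁻¹ • w) * modeOp Q (r / 2) (r⁻¹ • w) = modeOp Q T w := by
  have hT : T = (r ^ 2 - 2) / 2 := by rw [hr]; ring
  simp only [modeOp, mul_add, add_mul, mul_sub, sub_mul, one_mul, mul_one, smul_mul_assoc,
    mul_smul_comm, hQ, hQw, hwQ, hw, hT]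
  match_scalars <;> field_simp <;> ring

/-- The halved operator again satisfies the hypothesis of `modeOp_half_sq`, so halving can be
repeated. The second halving is what proves positivity of the first root. -/
theorem sq_half_smul {Q w : A} {T r : ℂ} (hr : r ^ 2 = 2 * T + 2) (hr0 : r ≠ 0)
    (hw : w * w = (T ^ 2 - 1) • Q) :
    (r⁻¹ • w) * (r⁻¹ • w) = ((r / 2) ^ 2 - 1) • Q := by
  have hT : T = (r ^ 2 - 2) / 2 := by rw [hr]; ring
  rw [smul_mul_smul_comm, hw, hT, smul_smul]
  congr 1
  field_simp
  ring

-- The relation `hanti` says that `w` and `w'` are pseudo-spins in directions whose angle has cosine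
-- `c`. It yields the reflection `w w' w = 2c w - w'`, so the threefold product stays in the span of
-- `1`, `Q`, `w`, `w'`.
set_option linter.unnecessarySeqFocus false in
theorem modeOp_sandwich {Q w w' : A} {c C S c' s' : ℂ} (hQ : Q * Q = Q) (hw : w * w = Q)
    (hQw : Q * w = w) (hwQ : w * Q = w) (hQw' : Q * w' = w') (hwQ' : w' * Q = w')
    (hanti : w' * w = (2 * c) • Q - w * w') (hCS : C ^ 2 - S ^ 2 = 1) :
    modeOp Q C (S • w) * modeOp Q c' (s' • w') * modeOp Q C (S • w) =
      modeOp Q (c' * (C ^ 2 + S ^ 2) + s' * (2 * C * S) * c)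
        ((c' * (2 * C * S) + s' * c * (2 * S ^ 2)) • w + s' • w') := by
  have h1 : w * (w' * w) = (2 * c) • w - w' := by
    rw [hanti, mul_sub, mul_smul_comm, hwQ, ← mul_assoc, hw, hQw']
  have hC : C ^ 2 = 1 + S ^ 2 := by linear_combination hCS
  simp only [modeOp, mul_add, add_mul, mul_sub, sub_mul, one_mul, mul_one, smul_mul_assoc,
    mul_smul_comm, mul_assoc, hQ, hw, hQw, hwQ, hQw', hwQ', h1, smul_add, smul_sub, smul_smul]
  rw [hanti]
  match_scalars <;> ring_nf <;> simp only [hC] <;> ring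

theorem add_smul_sq {Q w w' : A} {c x y : ℂ} (hw : w * w = Q) (hw' : w' * w' = Q)
    (hanti : w' * w = (2 * c) • Q - w * w') :
    (x • w + y • w') * (x • w + y • w') = (x ^ 2 + y ^ 2 + 2 * x * y * c) • Q := by
  simp only [mul_add, add_mul, smul_mul_assoc, mul_smul_comm, hw, hw', hanti]
  module

/-- Multiplicativity of the 2×2 determinant in coordinates: the three factors have determinant one,
hence so does their product, which is the relation `W² = T² - 1` needed for taking roots. -/
theorem sandwich_scalar {c C S c' s' : ℂ} (hCS : C ^ 2 - S ^ 2 = 1) (hcs' : c' ^ 2 - s' ^ 2 = 1) :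
    (c' * (2 * C * S) + s' * c * (2 * S ^ 2)) ^ 2 + s' ^ 2 +
        2 * (c' * (2 * C * S) + s' * c * (2 * S ^ 2)) * s' * c =
      (c' * (C ^ 2 + S ^ 2) + s' * (2 * C * S) * c) ^ 2 - 1 := by
  have hC : C ^ 2 = 1 + S ^ 2 := by linear_combination hCS
  have hc : s' ^ 2 = c' ^ 2 - 1 := by linear_combination -hcs'
  have hC4 : C ^ 4 = (1 + S ^ 2) ^ 2 := by rw [← hC]; ring
  have hC3 : C ^ 3 = (1 + S ^ 2) * C := by rw [← hC]; ring
  ring_nf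
  simp only [hC4, hC3, hC, hc]
  ring

end Mode

/-! ## Products over lists of independent factors -/

section Lists

variable {β M : Type*} [Monoid M] {r : β → β → Prop}

theorem commute_prod_map {x : M} {g : β → M} (L : List β) (h : ∀ b ∈ L, Commute x (g b)) :
    Commute x (L.map g).prod := by
  induction L with
  | nil => simp
  | cons b L ih =>
    rw [List.map_cons, List.prod_cons]
    exact (h b (by simp)).mul_right (ih fun c hc => h c (by simp [hc]))

theorem prod_map_mul_prod_map {f g : β → M} {L : List β} (hL : L.Pairwise r)
    (h : ∀ a b, r a b → Commute (f b) (g a)) :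
    (L.map f).prod * (L.map g).prod = (L.map fun b => f b * g b).prod := by
  induction L with
  | nil => simp
  | cons b L ih =>
    rw [List.pairwise_cons] at hL
    simp only [List.map_cons, List.prod_cons, ← ih hL.2]
    have : Commute (g b) (L.map f).prod :=
      commute_prod_map L fun a ha => (h b a (hL.1 a ha)).symm
    rw [mul_assoc, ← mul_assoc _ (g b), ← this.eq]
    simp only [mul_assoc]

theorem exp_sum_map {n : Type*} [Fintype n] [DecidableEq n] {f : β → Matrix n n ℂ}
    {L : List β} (hL : L.Pairwise r) (h : ∀ a b, r a b → Commute (f a) (f b)) :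
    NormedSpace.exp (L.map f).sum = (L.map fun b => NormedSpace.exp (f b)).prod := by
  induction L with
  | nil => simp
  | cons b L ih =>
    rw [List.pairwise_cons] at hL
    simp only [List.map_cons, List.prod_cons, List.sum_cons, ← ih hL.2]
    refine Matrix.exp_add_of_commute _ _ (Commute.list_sum_right _ _ fun a ha => ?_)
    obtain ⟨c, hc, rfl⟩ := List.mem_map.mp ha
    exact h b c (hL.1 c hc)

theorem prod_map_isHermitian {n : Type*} [Fintype n] [DecidableEq n] {f : β → Matrix n n ℂ}
    {L : List β} (hL : L.Pairwise r) (h : ∀ a b, r a b → Commute (f a) (f b))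
    (hf : ∀ a ∈ L, (f a).IsHermitian) : (L.map f).prod.IsHermitian := by
  induction L with
  | nil => simp
  | cons b L ih =>
    rw [List.pairwise_cons] at hL
    have h1 := ih hL.2 fun a ha => hf a (by simp [ha])
    have h2 : Commute (f b) (L.map f).prod :=
      commute_prod_map L fun a ha => h b a (hL.1 a ha)
    rw [Matrix.IsHermitian, List.map_cons, List.prod_cons, Matrix.conjTranspose_mul, h1.eq,
      (hf b (by simp)).eq, h2.eq]

theorem prod_map_smul {n : Type*} [Fintype n] [DecidableEq n] (k : β → ℂ) (f : β → Matrix n n ℂ)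
    (L : List β) : (L.map fun b => k b • f b).prod = (L.map k).prod • (L.map f).prod := by
  induction L with
  | nil => simp
  | cons b L ih => simp only [List.map_cons, List.prod_cons, ih, smul_mul_smul_comm]

end Lists

/-! ## Independent blocks of Majorana modes -/

section Block

variable {n : Type*} [Fintype n] [DecidableEq n]

/-- The algebra generated by the products of two Majorana operators with labels in `S`. -/
def evenAlg (γ : Bool → ℕ → Matrix n n ℂ) (S : Set ℕ) : Subalgebra ℂ (Matrix n n ℂ) :=
  Algebra.adjoin ℂ {x | ∃ b c i j, i ∈ S ∧ j ∈ S ∧ x = γ b i * γ c j}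

/-- A group of Majorana modes with local exponents `hp` and `hq`, the square root `s` of
`exp hp * exp hq * exp hp`, its own square root `z`, and the local parity `P`. -/
structure Block (γ : Bool → ℕ → Matrix n n ℂ) where
  /-- labels of the modes -/
  idx : Set ℕ
  /-- outer exponent -/
  hp : Matrix n n ℂ
  /-- inner exponent -/
  hq : Matrix n n ℂ
  /-- square root of the sandwiched exponentials -/
  s : Matrix n n ℂ
  /-- square root of `s` -/
  z : Matrix n n ℂ
  /-- local parity -/
  P : Matrix n n ℂ
  /-- local magnetization -/
  nz : Matrix n n ℂ
  /-- phase relating the rotation generated by `nz` and `P` -/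
  κ : ℂ
  /-- normalized trace of `s` -/
  tp : ℂ
  /-- normalized trace of `P * s` -/
  tm : ℂ
  hp_mem : hp ∈ evenAlg γ idx
  hq_mem : hq ∈ evenAlg γ idx
  s_mem : s ∈ evenAlg γ idx
  z_mem : z ∈ evenAlg γ idx
  P_mem : P ∈ evenAlg γ idx
  nz_mem : nz ∈ evenAlg γ idx
  sandwich : NormedSpace.exp hp * NormedSpace.exp hq * NormedSpace.exp hp = s * s
  z_mul_self : z * z = s
  z_isHermitian : z.IsHermitian
  exp_nz : NormedSpace.exp ((-(Real.pi / 2 * Complex.I)) • nz) = κ • P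
  trace_s : ∀ R, (∀ b, ∀ i ∈ idx, Commute (γ b i) R) → (s * R).trace = tp * R.trace
  trace_P_s : ∀ R, (∀ b, ∀ i ∈ idx, Commute (γ b i) R) → (P * s * R).trace = tm * R.trace

variable {γ : Bool → ℕ → Matrix n n ℂ}

/-- Two blocks are independent if their Majorana operators anticommute. -/
def Block.Indep (X Y : Block γ) : Prop :=
  ∀ b c, ∀ i ∈ X.idx, ∀ j ∈ Y.idx, γ b i * γ c j = -(γ c j * γ b i)

theorem mul_commute_of_anticomm {A : Type*} [Ring A] {x y u : A} (hx : x * u = -(u * x))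
    (hy : y * u = -(u * y)) : Commute (x * y) u := by
  rw [Commute, SemiconjBy, mul_assoc, hy, mul_neg, ← mul_assoc, hx, neg_mul, neg_neg, mul_assoc]

/-- The centralizer of `u` is a subalgebra, so commutation need only be checked on generators. -/
theorem commute_evenAlg {S : Set ℕ} {u x : Matrix n n ℂ} (hx : x ∈ evenAlg γ S)
    (hu : ∀ b c, ∀ i ∈ S, ∀ j ∈ S, Commute (γ b i * γ c j) u) : Commute x u := by
  have : evenAlg γ S ≤ Subalgebra.centralizer ℂ {u} := by
    refine Algebra.adjoin_le ?_
    rintro _ ⟨b, c, i, j, hi, hj, rfl⟩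
    rw [SetLike.mem_coe, Subalgebra.mem_centralizer_iff]
    rintro _ rfl
    exact ((hu b c i hi j hj).eq).symm
  exact ((Subalgebra.mem_centralizer_iff ℂ).mp (this hx) u rfl).symm

theorem commute_evenAlg_of_anticomm {S : Set ℕ} {u x : Matrix n n ℂ} (hx : x ∈ evenAlg γ S)
    (hu : ∀ b, ∀ i ∈ S, γ b i * u = -(u * γ b i)) : Commute x u :=
  commute_evenAlg hx fun b c i hi j hj => mul_commute_of_anticomm (hu b i hi) (hu c j hj)

theorem commute_evenAlg_of_commute {S : Set ℕ} {u x : Matrix n n ℂ} (hx : x ∈ evenAlg γ S)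
    (hu : ∀ b, ∀ i ∈ S, Commute (γ b i) u) : Commute x u :=
  commute_evenAlg hx fun b c i hi j hj => (hu b i hi).mul_left (hu c j hj)

namespace Block

/-- Passing a Majorana operator of `X` through a product of two from `Y` costs two signs, which
cancel. This is why the blocks are built from even elements. -/
theorem Indep.commute_gen {X Y : Block γ} (h : X.Indep Y) {x : Matrix n n ℂ}
    (hx : x ∈ evenAlg γ Y.idx) (b : Bool) {i : ℕ} (hi : i ∈ X.idx) : Commute (γ b i) x :=
  (commute_evenAlg_of_anticomm hx fun c j hj => by rw [h b c i hi j hj, neg_neg]).symm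

theorem Indep.commute {X Y : Block γ} (h : X.Indep Y) {x y : Matrix n n ℂ}
    (hx : x ∈ evenAlg γ X.idx) (hy : y ∈ evenAlg γ Y.idx) : Commute x y :=
  commute_evenAlg_of_commute hx fun b _ hi => h.commute_gen hy b hi

/-- The parity of a list of blocks. -/
def prodP (L : List (Block γ)) : Matrix n n ℂ := (L.map P).prod

/-- The product of the local square roots. -/
def prodS (L : List (Block γ)) : Matrix n n ℂ := (L.map s).prod

/-- The product of the square roots of the local square roots. -/
def prodZ (L : List (Block γ)) : Matrix n n ℂ := (L.map z).prod

variable {L : List (Block γ)}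

theorem prodZ_mul_self (hL : L.Pairwise Indep) : prodZ L * prodZ L = prodS L := by
  rw [prodZ, prod_map_mul_prod_map hL fun X Y h => (h.commute X.z_mem Y.z_mem).symm, prodS]
  simp only [z_mul_self]

theorem prodZ_isHermitian (hL : L.Pairwise Indep) : (prodZ L).IsHermitian :=
  prod_map_isHermitian hL (fun X Y h => h.commute X.z_mem Y.z_mem) fun X _ => X.z_isHermitian

theorem exp_sandwich (hL : L.Pairwise Indep) :
    NormedSpace.exp (L.map hp).sum * NormedSpace.exp (L.map hq).sum *
      NormedSpace.exp (L.map hp).sum = prodS L * prodS L := by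
  rw [exp_sum_map hL fun X Y h => h.commute X.hp_mem Y.hp_mem,
    exp_sum_map hL fun X Y h => h.commute X.hq_mem Y.hq_mem,
    prod_map_mul_prod_map hL fun X Y h => commute_exp (h.commute X.hq_mem Y.hp_mem).symm,
    prod_map_mul_prod_map hL fun X Y h =>
      (commute_exp (h.commute X.hp_mem Y.hp_mem).symm).mul_left
        (commute_exp (h.commute X.hp_mem Y.hq_mem).symm),
    prodS, prod_map_mul_prod_map hL fun X Y h => (h.commute X.s_mem Y.s_mem).symm]
  simp only [sandwich]

theorem exp_sum_nz (hL : L.Pairwise Indep) :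
    NormedSpace.exp ((-(Real.pi / 2 * Complex.I)) • (L.map nz).sum) =
      (L.map κ).prod • prodP L := by
  have : (-(Real.pi / 2 * Complex.I)) • (L.map nz).sum =
      (L.map fun X => (-(Real.pi / 2 * Complex.I)) • X.nz).sum := by
    rw [List.smul_sum, List.map_map]; rfl
  rw [this, exp_sum_map hL fun X Y h =>
    ((h.commute X.nz_mem Y.nz_mem).smul_left _).smul_right _]
  simp only [exp_nz, prod_map_smul, prodP]

/-- The product over the remaining blocks is even in their modes and commutes with the Majorana
operators of the first, so it serves as `R` in the local trace identity. The blocks are peeled off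
one at a time until the trace of `1`, the dimension, is left. -/
theorem trace_prod {f : Block γ → Matrix n n ℂ} {t : Block γ → ℂ} (hL : L.Pairwise Indep)
    (hf : ∀ X ∈ L, f X ∈ evenAlg γ X.idx)
    (ht : ∀ X ∈ L, ∀ R, (∀ b, ∀ i ∈ X.idx, Commute (γ b i) R) →
      (f X * R).trace = t X * R.trace) :
    ((L.map f).prod).trace = (L.map t).prod * Fintype.card n := by
  induction L with
  | nil => simp
  | cons X L ih =>
    rw [List.pairwise_cons] at hL
    rw [List.map_cons, List.prod_cons, List.map_cons, List.prod_cons,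
      ht X (by simp) _ fun b i hi => commute_prod_map L fun Y hY =>
        (hL.1 Y hY).commute_gen (hf Y (by simp [hY])) b hi,
      ih hL.2 (fun Y hY => hf Y (by simp [hY])) fun Y hY => ht Y (by simp [hY]), mul_assoc]

theorem trace_prodS (hL : L.Pairwise Indep) :
    (prodS L).trace = (L.map tp).prod * Fintype.card n :=
  trace_prod hL (fun X _ => X.s_mem) fun X _ => X.trace_s

theorem trace_prodP_mul_prodS (hL : L.Pairwise Indep) :
    (prodP L * prodS L).trace = (L.map tm).prod * Fintype.card n := by
  rw [prodP, prodS, prod_map_mul_prod_map hL fun X Y h => (h.commute X.s_mem Y.P_mem).symm]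
  exact trace_prod hL (fun X _ => mul_mem X.P_mem X.s_mem) fun X _ => X.trace_P_s

end Block

end Block

/-! ## Majorana families -/

/-- The first `N` members of `γ false` and `γ true` are Majorana operators. -/
structure IsMajorana {n : Type*} [Fintype n] [DecidableEq n] (N : ℕ)
    (γ : Bool → ℕ → Matrix n n ℂ) : Prop where
  isHermitian : ∀ b, ∀ i < N, (γ b i).IsHermitian
  mul_self : ∀ b, ∀ i < N, γ b i * γ b i = 1
  anticomm : ∀ b c, ∀ i < N, ∀ j < N, (b, i) ≠ (c, j) → γ b i * γ c j = -(γ c j * γ b i)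

section Pair

variable {A : Type*} [Ring A]

/-- The relations of four Majorana operators, oriented towards normal order. -/
structure FourMajorana (a₁ a₂ b₁ b₂ : A) : Prop where
  a₁a₁ : a₁ * a₁ = 1
  a₂a₂ : a₂ * a₂ = 1
  b₁b₁ : b₁ * b₁ = 1
  b₂b₂ : b₂ * b₂ = 1
  a₂a₁ : a₂ * a₁ = -(a₁ * a₂)
  b₁a₁ : b₁ * a₁ = -(a₁ * b₁)
  b₁a₂ : b₁ * a₂ = -(a₂ * b₁)
  b₂a₁ : b₂ * a₁ = -(a₁ * b₂)
  b₂a₂ : b₂ * a₂ = -(a₂ * b₂)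
  b₂b₁ : b₂ * b₁ = -(b₁ * b₂)

theorem mul_mul_of_eq_one {x : A} (h : x * x = 1) (y : A) : x * (x * y) = y := by
  rw [← mul_assoc, h, one_mul]

theorem mul_mul_of_eq_neg {x y : A} (h : x * y = -(y * x)) (z : A) :
    x * (y * z) = -(y * (x * z)) := by
  rw [← mul_assoc, h, neg_mul, mul_assoc]

end Pair

-- All products are brought to normal order by rewriting. The `mul_mul_of_*` rules are needed
-- because under right-nested association the two factors to be exchanged are followed by a tail.
set_option linter.unusedSimpArgs false in
theorem FourMajorana.relations {A : Type*} [Ring A] {a₁ a₂ b₁ b₂ : A}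
    (h : FourMajorana a₁ a₂ b₁ b₂) :
    (b₁ * a₁ + b₂ * a₂) * (b₁ * a₁ + b₂ * a₂) =
        (b₁ * a₁ * b₂ * a₂ - 1) + (b₁ * a₁ * b₂ * a₂ - 1) ∧
      (b₂ * a₁ - b₁ * a₂) * (b₂ * a₁ - b₁ * a₂) =
        (b₁ * a₁ * b₂ * a₂ - 1) + (b₁ * a₁ * b₂ * a₂ - 1) ∧
      (b₂ * a₁ - b₁ * a₂) * (b₁ * a₁ + b₂ * a₂) =
        -((b₁ * a₁ + b₂ * a₂) * (b₂ * a₁ - b₁ * a₂)) ∧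
      (b₁ * a₁ * b₂ * a₂) * (b₁ * a₁ * b₂ * a₂) = 1 ∧
      (b₁ * a₁ * b₂ * a₂) * (b₁ * a₁ + b₂ * a₂) = -(b₁ * a₁ + b₂ * a₂) ∧
      (b₁ * a₁ * b₂ * a₂) * (b₂ * a₁ - b₁ * a₂) = -(b₂ * a₁ - b₁ * a₂) ∧
      (b₁ * a₁ + b₂ * a₂) * (b₁ * a₁ * b₂ * a₂) = -(b₁ * a₁ + b₂ * a₂) ∧
      (b₂ * a₁ - b₁ * a₂) * (b₁ * a₁ * b₂ * a₂) = -(b₂ * a₁ - b₁ * a₂) := by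
  obtain ⟨h1, h2, h3, h4, h5, h6, h7, h8, h9, h10⟩ := h
  refine ⟨?_, ?_, ?_, ?_, ?_, ?_, ?_, ?_⟩ <;>
    simp only [mul_add, add_mul, mul_sub, sub_mul, mul_assoc, h1, h2, h3, h4, h5, h6, h7, h8, h9,
      h10, mul_neg, neg_mul, neg_neg, mul_one, mul_mul_of_eq_one h1, mul_mul_of_eq_one h2,
      mul_mul_of_eq_one h3, mul_mul_of_eq_one h4, mul_mul_of_eq_neg h5, mul_mul_of_eq_neg h6,
      mul_mul_of_eq_neg h7, mul_mul_of_eq_neg h8, mul_mul_of_eq_neg h9, mul_mul_of_eq_neg h10] <;>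
    abel

/-- Cyclicity moves `x` around to give `y * x`, anticommutation gives `-(y * x)`; the trace equals
its own negative. -/
theorem trace_mul_mul_eq_zero {n : Type*} [Fintype n] {x y R : Matrix n n ℂ}
    (h : x * y = -(y * x)) (hx : Commute x R) :
    (x * y * R).trace = 0 := by
  have h1 : (x * y * R).trace = (y * x * R).trace := by
    rw [mul_assoc, Matrix.trace_mul_comm, mul_assoc, ← hx.eq, mul_assoc]
  have h2 : (x * y * R).trace = -(y * x * R).trace := by rw [h, neg_mul, Matrix.trace_neg]
  linear_combination (h1 + h2) / 2

theorem real_smul_isHermitian {n : Type*} {M : Matrix n n ℂ} (hM : M.IsHermitian) (x : ℝ) :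
    ((x : ℂ) • M).IsHermitian := by
  rw [Matrix.IsHermitian, Matrix.conjTranspose_smul, hM.eq]
  simp

/-! ### The pseudo-spin algebra of a pair of modes -/

section Pair

variable {n : Type*} [Fintype n] [DecidableEq n] {N : ℕ} {γ : Bool → ℕ → Matrix n n ℂ}

theorem IsMajorana.fourMajorana (hγ : IsMajorana N γ) {i j : ℕ} (hi : i < N) (hj : j < N)
    (hij : i ≠ j) : FourMajorana (γ false i) (γ false j) (γ true i) (γ true j) where
  a₁a₁ := hγ.mul_self _ _ hi
  a₂a₂ := hγ.mul_self _ _ hj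
  b₁b₁ := hγ.mul_self _ _ hi
  b₂b₂ := hγ.mul_self _ _ hj
  a₂a₁ := hγ.anticomm _ _ _ hj _ hi (by simp [hij.symm])
  b₁a₁ := hγ.anticomm _ _ _ hi _ hi (by simp)
  b₁a₂ := hγ.anticomm _ _ _ hi _ hj (by simp)
  b₂a₁ := hγ.anticomm _ _ _ hj _ hi (by simp)
  b₂a₂ := hγ.anticomm _ _ _ hj _ hj (by simp)
  b₂b₁ := hγ.anticomm _ _ _ hj _ hi (by simp [hij.symm])

/-- The component of the pseudo-spin of the modes `i` and `j` along the field. -/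
noncomputable def pairZ (γ : Bool → ℕ → Matrix n n ℂ) (i j : ℕ) : Matrix n n ℂ :=
  (Complex.I / 2) • (γ true i * γ false i + γ true j * γ false j)

/-- The transverse component of the pseudo-spin of the modes `i` and `j`. -/
noncomputable def pairX (γ : Bool → ℕ → Matrix n n ℂ) (i j : ℕ) : Matrix n n ℂ :=
  (Complex.I / 2) • (γ true j * γ false i - γ true i * γ false j)

/-- The parity of the modes `i` and `j`. -/
def pairP (γ : Bool → ℕ → Matrix n n ℂ) (i j : ℕ) : Matrix n n ℂ :=
  -(γ true i * γ false i * γ true j * γ false j)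

/-- The projection onto even parity of the modes `i` and `j`. -/
noncomputable def pairQ (γ : Bool → ℕ → Matrix n n ℂ) (i j : ℕ) : Matrix n n ℂ :=
  (1 / 2 : ℂ) • (1 + pairP γ i j)

theorem mul_mem_evenAlg (γ : Bool → ℕ → Matrix n n ℂ) {S : Set ℕ} (b c : Bool) {i j : ℕ}
    (hi : i ∈ S) (hj : j ∈ S) : γ b i * γ c j ∈ evenAlg γ S :=
  Algebra.subset_adjoin ⟨b, c, i, j, hi, hj, rfl⟩

variable {i j : ℕ}

theorem pairZ_mem : pairZ γ i j ∈ evenAlg γ {i, j} :=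
  Subalgebra.smul_mem _ (add_mem (mul_mem_evenAlg _ _ _ (by simp) (by simp))
    (mul_mem_evenAlg _ _ _ (by simp) (by simp))) _

theorem pairX_mem : pairX γ i j ∈ evenAlg γ {i, j} :=
  Subalgebra.smul_mem _ (sub_mem (mul_mem_evenAlg _ _ _ (by simp) (by simp))
    (mul_mem_evenAlg _ _ _ (by simp) (by simp))) _

theorem pairP_mem : pairP γ i j ∈ evenAlg γ {i, j} := by
  rw [pairP, mul_assoc (γ true i * γ false i)]
  exact neg_mem (mul_mem (mul_mem_evenAlg _ _ _ (by simp) (by simp))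
    (mul_mem_evenAlg _ _ _ (by simp) (by simp)))

theorem pairQ_mem : pairQ γ i j ∈ evenAlg γ {i, j} :=
  Subalgebra.smul_mem _ (add_mem (one_mem _) pairP_mem) _

/-- The relations between the pseudo-spin components and the parity of a pair of modes. -/
structure PairRelations (Q Z X P : Matrix n n ℂ) : Prop where
  QQ : Q * Q = Q
  ZZ : Z * Z = Q
  XX : X * X = Q
  XZ : X * Z = -(Z * X)
  QZ : Q * Z = Z
  ZQ : Z * Q = Z
  QX : Q * X = X
  XQ : X * Q = X
  PQ : P * Q = Q
  PZ : P * Z = Z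
  PX : P * X = X
  Q_eq : Q = (1 / 2 : ℂ) • (1 + P)
  Q_isHermitian : Q.IsHermitian
  Z_isHermitian : Z.IsHermitian
  X_isHermitian : X.IsHermitian

theorem IsMajorana.isHermitian_I_smul (hγ : IsMajorana N γ) {b c : Bool} {i j : ℕ} (hi : i < N)
    (hj : j < N) (h : (b, i) ≠ (c, j)) : (Complex.I • (γ b i * γ c j)).IsHermitian := by
  rw [Matrix.IsHermitian, Matrix.conjTranspose_smul, Matrix.conjTranspose_mul,
    (hγ.isHermitian b i hi).eq, (hγ.isHermitian c j hj).eq, hγ.anticomm b c i hi j hj h]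
  simp

theorem IsMajorana.pairRelations (hγ : IsMajorana N γ) (hi : i < N) (hj : j < N) (hij : i ≠ j) :
    PairRelations (pairQ γ i j) (pairZ γ i j) (pairX γ i j) (pairP γ i j) := by
  obtain ⟨h1, h2, h3, h4, h5, h6, h7, h8⟩ := (hγ.fourMajorana hi hj hij).relations
  have hZ : (pairZ γ i j).IsHermitian := by
    have : pairZ γ i j = ((1 / 2 : ℝ) : ℂ) •
        (Complex.I • (γ true i * γ false i) + Complex.I • (γ true j * γ false j)) := by
      rw [pairZ]; push_cast; module
    rw [this]
    exact real_smul_isHermitian ((hγ.isHermitian_I_smul hi hi (by simp)).add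
      (hγ.isHermitian_I_smul hj hj (by simp))) _
  have hX : (pairX γ i j).IsHermitian := by
    have : pairX γ i j = ((1 / 2 : ℝ) : ℂ) •
        (Complex.I • (γ true j * γ false i) - Complex.I • (γ true i * γ false j)) := by
      rw [pairX]; push_cast; module
    rw [this]
    exact real_smul_isHermitian ((hγ.isHermitian_I_smul hj hi (by simp)).sub
      (hγ.isHermitian_I_smul hi hj (by simp))) _
  have hI : Complex.I / 2 * (Complex.I / 2) = -(1 / 4) := by
    linear_combination Complex.I_mul_I / 4
  have hZZ : pairZ γ i j * pairZ γ i j = pairQ γ i j := by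
    rw [pairZ, smul_mul_smul_comm, h1, hI, pairQ, pairP]
    module
  have hXX : pairX γ i j * pairX γ i j = pairQ γ i j := by
    rw [pairX, smul_mul_smul_comm, h2, hI, pairQ, pairP]
    module
  have hPZ : pairP γ i j * pairZ γ i j = pairZ γ i j := by
    rw [pairP, pairZ, neg_mul, mul_smul_comm, h5]; module
  have hPX : pairP γ i j * pairX γ i j = pairX γ i j := by
    rw [pairP, pairX, neg_mul, mul_smul_comm, h6]; module
  have hZP : pairZ γ i j * pairP γ i j = pairZ γ i j := by
    rw [pairP, pairZ, mul_neg, smul_mul_assoc, h7]; module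
  have hXP : pairX γ i j * pairP γ i j = pairX γ i j := by
    rw [pairP, pairX, mul_neg, smul_mul_assoc, h8]; module
  have hPP : pairP γ i j * pairP γ i j = 1 := by
    rw [pairP, neg_mul_neg, h4]
  constructor
  · rw [pairQ, smul_mul_smul_comm]
    simp only [mul_add, add_mul, hPP, one_mul, mul_one]
    module
  · exact hZZ
  · exact hXX
  · rw [pairX, pairZ, smul_mul_smul_comm, smul_mul_smul_comm, h3, smul_neg]
  · rw [pairQ, smul_mul_assoc, add_mul, one_mul, hPZ]; module
  · rw [pairQ, mul_smul_comm, mul_add, mul_one, hZP]; module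
  · rw [pairQ, smul_mul_assoc, add_mul, one_mul, hPX]; module
  · rw [pairQ, mul_smul_comm, mul_add, mul_one, hXP]; module
  · rw [pairQ, mul_smul_comm, mul_add, mul_one, hPP]; module
  · exact hPZ
  · exact hPX
  · rfl
  · rw [← hZZ, Matrix.IsHermitian, Matrix.conjTranspose_mul, hZ.eq]
  · exact hZ
  · exact hX

theorem IsMajorana.pair_traces (hγ : IsMajorana N γ) (hi : i < N) (hj : j < N) (hij : i ≠ j)
    {R : Matrix n n ℂ} (hR : ∀ b, ∀ k ∈ ({i, j} : Set ℕ), Commute (γ b k) R) :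
    (pairP γ i j * R).trace = 0 ∧ (pairZ γ i j * R).trace = 0 ∧
      (pairX γ i j * R).trace = 0 := by
  have hb1 := hR true i (by simp)
  have hb2 := hR true j (by simp)
  have hf := hγ.fourMajorana hi hj hij
  have e1 : (γ true i * γ false i * R).trace = 0 := trace_mul_mul_eq_zero hf.b₁a₁ hb1
  have e2 : (γ true j * γ false j * R).trace = 0 := trace_mul_mul_eq_zero hf.b₂a₂ hb2
  have e3 : (γ true j * γ false i * R).trace = 0 := trace_mul_mul_eq_zero hf.b₂a₁ hb2
  have e4 : (γ true i * γ false j * R).trace = 0 := trace_mul_mul_eq_zero hf.b₁a₂ hb1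
  -- The local parity is split as one Majorana operator times the other three, with which it
  -- anticommutes since three is odd.
  have e5 : (γ true i * (γ false i * γ true j * γ false j) * R).trace = 0 := by
    refine trace_mul_mul_eq_zero ?_ hb1
    have h := hf.b₂b₁
    have h' : γ true i * γ true j = -(γ true j * γ true i) := by rw [h, neg_neg]
    rw [mul_assoc (γ false i), mul_mul_of_eq_neg hf.b₁a₁, mul_mul_of_eq_neg h', hf.b₁a₂]
    simp only [mul_neg, neg_neg, mul_assoc]
  refine ⟨?_, ?_, ?_⟩
  · rw [pairP, neg_mul, Matrix.trace_neg, mul_assoc (γ true i * γ false i), mul_assoc (γ true i),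
      ← mul_assoc (γ false i), e5, neg_zero]
  · rw [pairZ, smul_mul_assoc, Matrix.trace_smul, add_mul, Matrix.trace_add, e1, e2]; simp
  · rw [pairX, smul_mul_assoc, Matrix.trace_smul, sub_mul, Matrix.trace_sub, e3, e4]; simp

end Pair

/-! ### Local square roots and their traces -/

section Blocks

variable {n : Type*} [Fintype n] [DecidableEq n] {N : ℕ} {γ : Bool → ℕ → Matrix n n ℂ}

theorem modeOp_isHermitian {Q w : Matrix n n ℂ} (hQ : Q.IsHermitian) (hw : w.IsHermitian)
    (x y : ℝ) : (modeOp Q (x : ℂ) ((y : ℂ) • w)).IsHermitian :=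
  ((Matrix.isHermitian_one.sub hQ).add (real_smul_isHermitian hQ x)).add
    (real_smul_isHermitian hw y)

/-- The fidelity computation in a single pair: the sandwich is `modeOp Q T W`, one halving gives its
root, and a second halving exhibits that root as the square of a Hermitian element. The equation for
`r` is `r² = 2T + 2`, expressed through the doubled arguments. -/
theorem exists_mode_sqrt {Q w w' : Matrix n n ℂ} (hQ : Q * Q = Q) (hw : w * w = Q)
    (hw' : w' * w' = Q) (hQw : Q * w = w) (hwQ : w * Q = w) (hQw' : Q * w' = w')
    (hwQ' : w' * Q = w') (hQh : Q.IsHermitian) (hwh : w.IsHermitian) (hwh' : w'.IsHermitian)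
    {a b c r : ℝ} (hanti : w' * w = (2 * (c : ℂ)) • Q - w * w') (hr0 : 0 < r)
    (hr : r ^ 2 = 2 * (Real.cosh (2 * a) * Real.cosh (2 * b) +
      Real.sinh (2 * a) * Real.sinh (2 * b) * c) + 2) :
    ∃ x y t x' y' : ℝ,
      NormedSpace.exp ((a : ℂ) • w) * NormedSpace.exp ((2 * b : ℂ) • w') *
          NormedSpace.exp ((a : ℂ) • w) =
        modeOp Q (r / 2 : ℂ) ((x : ℂ) • w + (y : ℂ) • w') *
          modeOp Q (r / 2 : ℂ) ((x : ℂ) • w + (y : ℂ) • w') ∧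
      modeOp Q (t : ℂ) ((x' : ℂ) • w + (y' : ℂ) • w') *
          modeOp Q (t : ℂ) ((x' : ℂ) • w + (y' : ℂ) • w') =
        modeOp Q (r / 2 : ℂ) ((x : ℂ) • w + (y : ℂ) • w') ∧
      (modeOp Q (t : ℂ) ((x' : ℂ) • w + (y' : ℂ) • w')).IsHermitian := by
  set C := Real.cosh a with hC
  set S := Real.sinh a with hS
  set c' := Real.cosh (2 * b) with hc'
  set s' := Real.sinh (2 * b) with hs'
  have hCS : C ^ 2 - S ^ 2 = 1 := by rw [hC, hS]; exact Real.cosh_sq_sub_sinh_sq a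
  have hcs' : c' ^ 2 - s' ^ 2 = 1 := by rw [hc', hs']; exact Real.cosh_sq_sub_sinh_sq _
  have hCS' : (C : ℂ) ^ 2 - (S : ℂ) ^ 2 = 1 := by exact_mod_cast hCS
  have hcs'' : (c' : ℂ) ^ 2 - (s' : ℂ) ^ 2 = 1 := by exact_mod_cast hcs'
  rw [Real.cosh_two_mul, Real.sinh_two_mul, ← hC, ← hS] at hr
  set T : ℂ := c' * (C ^ 2 + S ^ 2) + s' * (2 * C * S) * c with hT
  set ξ : ℝ := c' * (2 * C * S) + s' * c * (2 * S ^ 2) with hξ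
  -- The second halving replaces `T` by `r / 2`, so its parameter satisfies `t² = 2 (r / 2) + 2`.
  set t : ℝ := √(r + 2) with ht
  have ht0 : 0 < t := Real.sqrt_pos.mpr (by linarith)
  have htr : (t : ℂ) ^ 2 = 2 * ((r : ℂ) / 2) + 2 := by
    have : t ^ 2 = r + 2 := Real.sq_sqrt (by linarith)
    rw [mul_div_cancel₀ _ two_ne_zero]
    exact_mod_cast this
  have hrT : (r : ℂ) ^ 2 = 2 * T + 2 := by
    rw [hT]
    have := congrArg (fun x : ℝ => (x : ℂ)) hr
    push_cast at this
    rw [this]; ring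
  have hr0' : (r : ℂ) ≠ 0 := by exact_mod_cast hr0.ne'
  have ht0' : (t : ℂ) ≠ 0 := by exact_mod_cast ht0.ne'
  set W : Matrix n n ℂ := (ξ : ℂ) • w + (s' : ℂ) • w' with hW
  have hQW : Q * W = W := by rw [hW, mul_add, mul_smul_comm, mul_smul_comm, hQw, hQw']
  have hWQ : W * Q = W := by rw [hW, add_mul, smul_mul_assoc, smul_mul_assoc, hwQ, hwQ']
  have hWW : W * W = (T ^ 2 - 1) • Q := by
    rw [hW, add_smul_sq hw hw' hanti, hT, ← sandwich_scalar hCS' hcs'', hξ]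
    push_cast
    rfl
  have e1 : NormedSpace.exp ((a : ℂ) • w) = modeOp Q (C : ℂ) ((S : ℂ) • w) := by
    rw [exp_smul_of_sq_eq_idempotent hQ hw hQw hwQ, modeOp, hC, hS]; push_cast; rfl
  have e2 : NormedSpace.exp ((2 * b : ℂ) • w') = modeOp Q (c' : ℂ) ((s' : ℂ) • w') := by
    rw [exp_smul_of_sq_eq_idempotent hQ hw' hQw' hwQ', modeOp, hc', hs']; push_cast; rfl
  have f1 : ((r⁻¹ * ξ : ℝ) : ℂ) • w + ((r⁻¹ * s' : ℝ) : ℂ) • w' = (r : ℂ)⁻¹ • W := by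
    rw [hW]; push_cast; module
  have f2 : ((t⁻¹ * (r⁻¹ * ξ) : ℝ) : ℂ) • w + ((t⁻¹ * (r⁻¹ * s') : ℝ) : ℂ) • w' =
      (t : ℂ)⁻¹ • ((r : ℂ)⁻¹ • W) := by
    rw [hW]; push_cast; module
  refine ⟨r⁻¹ * ξ, r⁻¹ * s', t / 2, t⁻¹ * (r⁻¹ * ξ), t⁻¹ * (r⁻¹ * s'), ?_, ?_, ?_⟩
  · rw [f1, modeOp_half_sq hrT hr0' hQ hQW hWQ hWW, e1, e2,
      modeOp_sandwich hQ hw hQw hwQ hQw' hwQ' hanti hCS', hW, hT, hξ]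
    push_cast
    rfl
  · rw [f1, f2, Complex.ofReal_div, Complex.ofReal_ofNat]
    exact modeOp_half_sq htr ht0' hQ (by rw [mul_smul_comm, hQW]) (by rw [smul_mul_assoc, hWQ])
      (sq_half_smul hrT hr0' hWW)
  · have := modeOp_isHermitian (w := ((t⁻¹ * (r⁻¹ * ξ) : ℝ) : ℂ) • w +
      ((t⁻¹ * (r⁻¹ * s') : ℝ) : ℂ) • w') hQh
      ((real_smul_isHermitian hwh _).add (real_smul_isHermitian hwh' _)) (t / 2) 1
    rwa [Complex.ofReal_one, one_smul] at this

theorem modeOp_mem {S : Set ℕ} {Q w w' : Matrix n n ℂ} (hQ : Q ∈ evenAlg γ S)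
    (hw : w ∈ evenAlg γ S) (hw' : w' ∈ evenAlg γ S) (x y z : ℂ) :
    modeOp Q x (y • w + z • w') ∈ evenAlg γ S :=
  add_mem (add_mem (sub_mem (one_mem _) hQ) (Subalgebra.smul_mem _ hQ _))
    (add_mem (Subalgebra.smul_mem _ hw _) (Subalgebra.smul_mem _ hw' _))

/-- Normalized to the four states of a pair: the root is the identity on the two odd states and has
trace `r` on the two even ones. Weighting by the local parity flips the sign of the odd
contribution. -/
theorem IsMajorana.exists_pairBlock (hγ : IsMajorana N γ) {i j : ℕ} (hi : i < N) (hj : j < N)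
    (hij : i ≠ j) {a b φ ψ r : ℝ} (hr0 : 0 < r)
    (hr : r ^ 2 = 2 * (Real.cosh (2 * a) * Real.cosh (2 * b) +
      Real.sinh (2 * a) * Real.sinh (2 * b) * Real.cos (φ - ψ)) + 2) :
    ∃ B : Block γ, B.idx = {i, j} ∧
      B.hp = (a : ℂ) • ((Real.cos φ : ℂ) • pairZ γ i j - (Real.sin φ : ℂ) • pairX γ i j) ∧
      B.hq = (2 * b : ℂ) • ((Real.cos ψ : ℂ) • pairZ γ i j - (Real.sin ψ : ℂ) • pairX γ i j) ∧
      B.nz = (2 : ℂ) • pairZ γ i j ∧ B.κ = -1 ∧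
      B.tp = (r + 2) / 4 ∧ B.tm = (r - 2) / 4 := by
  obtain ⟨QQ, ZZ, XX, XZ, QZ, ZQ, QX, XQ, PQ, PZ, PX, Qe, Qh, Zh, Xh⟩ :=
    hγ.pairRelations hi hj hij
  set Q := pairQ γ i j
  set Z := pairZ γ i j with hZ
  set X := pairX γ i j with hX
  set P := pairP γ i j with hP
  have tr : ∀ R, (∀ b, ∀ k ∈ ({i, j} : Set ℕ), Commute (γ b k) R) →
      (P * R).trace = 0 ∧ (Z * R).trace = 0 ∧ (X * R).trace = 0 :=
    fun R hR => hγ.pair_traces hi hj hij hR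
  have hsc : ∀ φ : ℝ, (Real.cos φ : ℂ) ^ 2 + (Real.sin φ : ℂ) ^ 2 = 1 := fun φ => by
    exact_mod_cast Real.cos_sq_add_sin_sq φ
  let w : ℝ → Matrix n n ℂ := fun φ => (Real.cos φ : ℂ) • Z - (Real.sin φ : ℂ) • X
  have hww : ∀ φ, w φ * w φ = Q := fun φ => by
    have : w φ * w φ = ((Real.cos φ : ℂ) ^ 2 + (Real.sin φ : ℂ) ^ 2) • Q := by
      simp only [w, mul_sub, sub_mul, smul_mul_smul_comm, ZZ, XX, XZ]
      module
    rw [this, hsc, one_smul]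
  have hQw : ∀ φ, Q * w φ = w φ := fun φ => by
    simp only [w, mul_sub, mul_smul_comm, QZ, QX]
  have hwQ : ∀ φ, w φ * Q = w φ := fun φ => by
    simp only [w, sub_mul, smul_mul_assoc, ZQ, XQ]
  have hPw : ∀ φ, P * w φ = w φ := fun φ => by
    simp only [w, mul_sub, mul_smul_comm, PZ, PX]
  have hwh : ∀ φ, (w φ).IsHermitian := fun φ =>
    (real_smul_isHermitian Zh _).sub (real_smul_isHermitian Xh _)
  have hwm : ∀ φ, w φ ∈ evenAlg γ {i, j} := fun φ =>
    sub_mem (Subalgebra.smul_mem _ pairZ_mem _) (Subalgebra.smul_mem _ pairX_mem _)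
  have hanti : w ψ * w φ = (2 * (Real.cos (φ - ψ) : ℂ)) • Q - w φ * w ψ := by
    rw [Real.cos_sub]
    simp only [w, mul_sub, sub_mul, smul_mul_smul_comm, ZZ, XX, XZ]
    push_cast
    module
  have trw : ∀ φ R, (∀ b, ∀ k ∈ ({i, j} : Set ℕ), Commute (γ b k) R) →
      (w φ * R).trace = 0 := fun φ R hR => by
    obtain ⟨-, h2, h3⟩ := tr R hR
    simp only [w, sub_mul, smul_mul_assoc, Matrix.trace_sub, Matrix.trace_smul, h2, h3, smul_zero,
      sub_zero]
  have trQ : ∀ R, (∀ b, ∀ k ∈ ({i, j} : Set ℕ), Commute (γ b k) R) →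
      (Q * R).trace = R.trace / 2 := fun R hR => by
    rw [Qe, smul_mul_assoc, Matrix.trace_smul, add_mul, Matrix.trace_add, (tr R hR).1, one_mul,
      smul_eq_mul]
    ring
  obtain ⟨x, y, t, x', y', h1, h2, h3⟩ := exists_mode_sqrt QQ (hww φ) (hww ψ) (hQw φ) (hwQ φ)
    (hQw ψ) (hwQ ψ) Qh (hwh φ) (hwh ψ) hanti hr0 hr
  refine ⟨{
    idx := {i, j}
    hp := (a : ℂ) • w φ
    hq := (2 * b : ℂ) • w ψ
    s := modeOp Q (r / 2 : ℂ) ((x : ℂ) • w φ + (y : ℂ) • w ψ)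
    z := modeOp Q (t : ℂ) ((x' : ℂ) • w φ + (y' : ℂ) • w ψ)
    P := P
    nz := (2 : ℂ) • Z
    κ := -1
    tp := (r + 2) / 4
    tm := (r - 2) / 4
    hp_mem := Subalgebra.smul_mem _ (hwm φ) _
    hq_mem := Subalgebra.smul_mem _ (hwm ψ) _
    s_mem := modeOp_mem pairQ_mem (hwm φ) (hwm ψ) _ _ _
    z_mem := modeOp_mem pairQ_mem (hwm φ) (hwm ψ) _ _ _
    P_mem := pairP_mem
    nz_mem := Subalgebra.smul_mem _ pairZ_mem _
    sandwich := h1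
    z_mul_self := h2
    z_isHermitian := h3
    exp_nz := ?_
    trace_s := ?_
    trace_P_s := ?_ }, rfl, rfl, rfl, rfl, rfl, rfl, rfl⟩
  -- Since `nz = 2Z`, the exponential is that of `-iπ Z`, namely `1 - 2Q = -P`; hence `κ = -1`.
  · rw [smul_smul, exp_smul_of_sq_eq_idempotent QQ ZZ QZ ZQ,
      show -(Real.pi / 2 * Complex.I) * 2 = -(Real.pi * Complex.I) by ring, Complex.cosh_neg,
      Complex.sinh_neg, Complex.cosh_mul_I, Complex.sinh_mul_I, Complex.cos_pi, Complex.sin_pi, Qe]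
    module
  · intro R hR
    simp only [modeOp, add_mul, sub_mul, smul_mul_assoc, Matrix.trace_add, Matrix.trace_sub,
      Matrix.trace_smul, one_mul, trQ R hR, trw _ R hR, smul_eq_mul]
    ring
  · intro R hR
    simp only [modeOp, mul_add, mul_sub, mul_smul_comm, add_mul, sub_mul, smul_mul_assoc,
      Matrix.trace_add, Matrix.trace_sub, PQ, hPw, mul_one,
      Matrix.trace_smul, trQ R hR, trw _ R hR, (tr R hR).1, smul_eq_mul]
    ring

/-- Both exponents are multiples of the same involution, so the exponentials simply add their
arguments and roots halve them. -/
theorem IsMajorana.exists_singleBlock (hγ : IsMajorana N γ) {i : ℕ} (hi : i < N) (a b : ℝ) :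
    ∃ B : Block γ, B.idx = {i} ∧
      B.hp = (a : ℂ) • (Complex.I • (γ true i * γ false i)) ∧
      B.hq = (2 * b : ℂ) • (Complex.I • (γ true i * γ false i)) ∧
      B.nz = Complex.I • (γ true i * γ false i) ∧ B.κ = -Complex.I ∧
      B.tp = Real.cosh (a + b) ∧ B.tm = Real.sinh (a + b) := by
  have ha := hγ.mul_self false i hi
  have hb := hγ.mul_self true i hi
  have hba := hγ.anticomm true false i hi i hi (by simp)
  have hab : γ false i * γ true i = -(γ true i * γ false i) := by rw [hba, neg_neg]
  have hPh : (Complex.I • (γ true i * γ false i)).IsHermitian :=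
    hγ.isHermitian_I_smul hi hi (by simp)
  have hPP : (Complex.I • (γ true i * γ false i)) * (Complex.I • (γ true i * γ false i)) = 1 := by
    rw [smul_mul_smul_comm, Complex.I_mul_I, mul_assoc, ← mul_assoc (γ false i), hab, neg_mul,
      mul_assoc, ha, mul_one, mul_neg, hb]
    simp
  have hPm : Complex.I • (γ true i * γ false i) ∈ evenAlg γ {i} :=
    Subalgebra.smul_mem _ (mul_mem_evenAlg _ _ _ (by simp) (by simp)) _
  have htr : ∀ R, (∀ b, ∀ k ∈ ({i} : Set ℕ), Commute (γ b k) R) →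
      ((Complex.I • (γ true i * γ false i)) * R).trace = 0 := fun R hR => by
    rw [smul_mul_assoc, Matrix.trace_smul, trace_mul_mul_eq_zero hba (hR _ i (by simp)), smul_zero]
  set P := Complex.I • (γ true i * γ false i) with hP
  have hexp : ∀ c : ℂ, NormedSpace.exp (c • P) = Complex.cosh c • 1 + Complex.sinh c • P :=
    fun c => by
      rw [exp_smul_of_sq_eq_idempotent (one_mul 1) hPP (one_mul P) (mul_one P), sub_self, zero_add]
  have hadd : ∀ c d : ℂ, NormedSpace.exp (c • P) * NormedSpace.exp (d • P) =
      NormedSpace.exp ((c + d) • P) := fun c d => by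
    rw [add_smul, Matrix.exp_add_of_commute _ _
      (((Commute.refl P).smul_left _).smul_right _)]
  have hmem : ∀ c : ℂ, NormedSpace.exp (c • P) ∈ evenAlg γ {i} := fun c => by
    rw [hexp]
    exact add_mem (Subalgebra.smul_mem _ (one_mem _) _) (Subalgebra.smul_mem _ hPm _)
  refine ⟨{
    idx := {i}
    hp := (a : ℂ) • P
    hq := (2 * b : ℂ) • P
    s := NormedSpace.exp ((a + b : ℂ) • P)
    z := NormedSpace.exp (((a + b) / 2 : ℂ) • P)
    P := P
    nz := P
    κ := -Complex.I
    tp := Real.cosh (a + b)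
    tm := Real.sinh (a + b)
    hp_mem := Subalgebra.smul_mem _ hPm _
    hq_mem := Subalgebra.smul_mem _ hPm _
    s_mem := hmem _
    z_mem := hmem _
    P_mem := hPm
    nz_mem := hPm
    sandwich := ?_
    z_mul_self := ?_
    z_isHermitian := ?_
    exp_nz := ?_
    trace_s := ?_
    trace_P_s := ?_ }, rfl, rfl, rfl, rfl, rfl, rfl, rfl⟩
  · rw [hadd, hadd, hadd]
    congr 2
    ring
  · rw [hadd, add_halves]
  · have := (real_smul_isHermitian hPh ((a + b) / 2)).exp
    push_cast at this
    exact this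
  · rw [hexp, Complex.cosh_neg, Complex.sinh_neg, Complex.cosh_mul_I, Complex.sinh_mul_I,
      Complex.cos_pi_div_two, Complex.sin_pi_div_two]
    module
  · intro R hR
    rw [hexp, add_mul, smul_mul_assoc, smul_mul_assoc, Matrix.trace_add, Matrix.trace_smul,
      Matrix.trace_smul, htr R hR, one_mul]
    push_cast
    simp
  · intro R hR
    clear_value P
    rw [hexp, mul_add, mul_smul_comm, mul_smul_comm, hPP, mul_one, add_mul, smul_mul_assoc,
      smul_mul_assoc, Matrix.trace_add, Matrix.trace_smul,
      Matrix.trace_smul, htr R hR, one_mul]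
    push_cast
    simp

end Blocks

/-! ## The Hartley basis -/

section Hartley

/-- The momenta of the sector with boundary twist `(-1) ^ δ`. -/
noncomputable def momentum (N δ m : ℕ) : ℝ := (2 * m + δ) * Real.pi / N

/-- The function `cos + sin`. -/
noncomputable def cas (x : ℝ) : ℝ := Real.cos x + Real.sin x

theorem cas_mul_cas (x y : ℝ) : cas x * cas y = Real.cos (x - y) + Real.sin (x + y) := by
  rw [cas, cas, Real.cos_sub, Real.sin_add]; ring

theorem cas_add (x y : ℝ) : cas (x + y) = Real.cos y * cas x + Real.sin y * cas (-x) := by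
  rw [cas, cas, cas, Real.cos_add, Real.sin_add, Real.cos_neg, Real.sin_neg]; ring

/-- A geometric sum over the `N`-th roots of unity; the offset `δ` enters only as a common phase. -/
theorem sum_exp_momentum (N δ : ℕ) [NeZero N] {d : ℤ} (hd : ¬ (N : ℤ) ∣ d) :
    ∑ m ∈ Finset.range N, Complex.exp ((momentum N δ m * d : ℝ) * Complex.I) = 0 := by
  have hN : (N : ℂ) ≠ 0 := Nat.cast_ne_zero.mpr (NeZero.ne N)
  set ζ : ℂ := Complex.exp (2 * Real.pi * Complex.I / N) with hζ
  have hprim : IsPrimitiveRoot ζ N := Complex.isPrimitiveRoot_exp N (NeZero.ne N)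
  have h1 : ∀ m : ℕ, Complex.exp ((momentum N δ m * d : ℝ) * Complex.I) =
      Complex.exp ((δ * Real.pi / N * d : ℝ) * Complex.I) * (ζ ^ d) ^ m := fun m => by
    rw [hζ, ← Complex.exp_int_mul, ← Complex.exp_nat_mul, ← Complex.exp_add, momentum]
    congr 1
    push_cast
    field_simp
    ring
  have h2 : ζ ^ d ≠ 1 := fun h => hd ((hprim.zpow_eq_one_iff_dvd d).mp h)
  have h3 : (ζ ^ d) ^ N = 1 := by
    rw [← zpow_natCast, ← _root_.zpow_mul, mul_comm, _root_.zpow_mul, zpow_natCast,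
      hprim.pow_eq_one, _root_.one_zpow]
  rw [Finset.sum_congr rfl fun m _ => h1 m, ← Finset.mul_sum, geom_sum_eq h2, h3, sub_self,
    zero_div, mul_zero]

theorem sum_cos_momentum (N δ : ℕ) [NeZero N] {d : ℤ} (hd : ¬ (N : ℤ) ∣ d) :
    ∑ m ∈ Finset.range N, Real.cos (momentum N δ m * d) = 0 := by
  have h := congrArg Complex.re (sum_exp_momentum N δ hd)
  simpa only [Complex.re_sum, Complex.exp_ofReal_mul_I_re, Complex.zero_re] using h

/-- Divisibility is not excluded here: if `N ∣ d`, each argument is an integer multiple of `π`. This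
matters in `hartley_complete`, where `d = j + l` can be a multiple of `N`. -/
theorem sum_sin_momentum (N δ : ℕ) [NeZero N] (d : ℤ) :
    ∑ m ∈ Finset.range N, Real.sin (momentum N δ m * d) = 0 := by
  by_cases hd : (N : ℤ) ∣ d
  · obtain ⟨c, rfl⟩ := hd
    refine Finset.sum_eq_zero fun m _ => ?_
    have hN : (N : ℝ) ≠ 0 := Nat.cast_ne_zero.mpr (NeZero.ne N)
    rw [show momentum N δ m * ((N * c : ℤ) : ℝ) = (((2 * m + δ) * c : ℤ) : ℝ) * Real.pi by
      rw [momentum]; push_cast; field_simp]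
    exact Real.sin_int_mul_pi _
  · have h := congrArg Complex.im (sum_exp_momentum N δ hd)
    simpa only [Complex.im_sum, Complex.exp_ofReal_mul_I_im, Complex.zero_im] using h

/-- The Hartley vector of momentum `k`. -/
noncomputable def hartley (N : ℕ) (k : ℝ) (j : Fin N) : ℝ := cas (k * j) / √N

theorem hartley_complete (N δ : ℕ) [NeZero N] (j l : Fin N) :
    ∑ m ∈ Finset.range N, hartley N (momentum N δ m) j * hartley N (momentum N δ m) l =
      if j = l then 1 else 0 := by
  have hN : (N : ℝ) ≠ 0 := Nat.cast_ne_zero.mpr (NeZero.ne N)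
  have h1 : ∀ m : ℕ, hartley N (momentum N δ m) j * hartley N (momentum N δ m) l =
      (Real.cos (momentum N δ m * ((j.val - l.val : ℤ) : ℝ)) +
        Real.sin (momentum N δ m * ((j.val + l.val : ℤ) : ℝ))) / N := fun m => by
    rw [hartley, hartley, div_mul_div_comm, cas_mul_cas, Real.mul_self_sqrt (Nat.cast_nonneg N)]
    push_cast
    ring_nf
  rw [Finset.sum_congr rfl fun m _ => h1 m, ← Finset.sum_div, Finset.sum_add_distrib,
    sum_sin_momentum, add_zero]
  split_ifs with h
  · subst h
    simp [hN]
  · rw [sum_cos_momentum, zero_div]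
    intro hd
    have := Int.eq_zero_of_abs_lt_dvd hd (by have := j.isLt; have := l.isLt; rw [abs_lt]; omega)
    exact h (Fin.ext (by omega))

/-- For a square matrix a left inverse is a right inverse, so completeness implies orthonormality.
-/
theorem hartley_orthonormal (N δ : ℕ) [NeZero N] {m m' : ℕ} (hm : m < N) (hm' : m' < N) :
    ∑ j, hartley N (momentum N δ m) j * hartley N (momentum N δ m') j =
      if m = m' then 1 else 0 := by
  let Φ : Matrix (Fin N) (Fin N) ℝ := Matrix.of fun m j => hartley N (momentum N δ m) j
  have h1 : Φᵀ * Φ = 1 := by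
    ext j l
    rw [Matrix.mul_apply, Matrix.one_apply, ← hartley_complete N δ j l, Finset.sum_range]
    rfl
  have h2 : Φ * Φᵀ = 1 := mul_eq_one_comm.mp h1
  have h3 := congrFun (congrFun h2 ⟨m, hm⟩) ⟨m', hm'⟩
  rw [Matrix.mul_apply, Matrix.one_apply] at h3
  simpa [Φ] using h3

theorem hartley_two_pi_sub (N : ℕ) (k : ℝ) (j : Fin N) :
    hartley N (2 * Real.pi - k) j = hartley N (-k) j := by
  rw [hartley, hartley, cas, cas, show (2 * Real.pi - k) * j = -k * j + j * (2 * Real.pi) by ring,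
    Real.cos_add_nat_mul_two_pi, Real.sin_add_nat_mul_two_pi]

/-- The twist of the boundary bond. -/
def twist {N : ℕ} (δ : ℕ) (j : Fin N) : ℝ := if j.val + 1 = N then (-1) ^ δ else 1

theorem cas_momentum_mul (N δ m : ℕ) [NeZero N] : cas (momentum N δ m * N) = (-1) ^ δ := by
  have hN : (N : ℝ) ≠ 0 := Nat.cast_ne_zero.mpr (NeZero.ne N)
  rw [cas, show momentum N δ m * N = δ * Real.pi + m * (2 * Real.pi) by
      rw [momentum]; field_simp; ring,
    Real.cos_add_nat_mul_two_pi, Real.sin_add_nat_mul_two_pi, Real.sin_nat_mul_pi, add_zero,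
    Real.cos_nat_mul_pi]

/-- Translation acts on Hartley vectors by mixing `k` with `-k`. The twist matches the value `cas (k
* N) = (-1) ^ δ` at the end of the chain, so the formula also holds on the closing bond. -/
theorem hartley_shift (N δ m : ℕ) [NeZero N] (j : Fin N) :
    twist δ j * hartley N (momentum N δ m) (j + 1) =
      Real.cos (momentum N δ m) * hartley N (momentum N δ m) j +
        Real.sin (momentum N δ m) * hartley N (-momentum N δ m) j := by
  set k := momentum N δ m with hk
  have h1 : twist δ j * hartley N k (j + 1) = cas (k * j + k) / √N := by
    rw [twist, hartley]
    split_ifs with h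
    · have h1 : j + 1 = 0 := by
        ext; rw [Fin.val_add, Fin.val_one', Nat.add_mod_mod, h, Nat.mod_self]; rfl
      have h2 : k * j + k = k * N := by
        have : (j : ℝ) + 1 = N := by exact_mod_cast h
        rw [← this]; ring
      rw [h1, h2, hk, cas_momentum_mul]
      simp [cas, div_eq_mul_inv]
    · have hv : (j + 1).val = j.val + 1 := by
        rw [Fin.val_add, Fin.val_one', Nat.add_mod_mod, Nat.mod_eq_of_lt]
        have := j.isLt; omega
      rw [hv, one_mul]
      push_cast
      ring_nf
  rw [h1, cas_add, hartley, hartley, neg_mul]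
  ring

end Hartley

/-! ## Majorana operators in momentum space -/

section Fourier

variable {N : ℕ}

/-- The Majorana operator of momentum `k`. -/
noncomputable def majK (N : ℕ) (b : Bool) (k : ℝ) : Op N :=
  ∑ j, (hartley N k j : ℂ) • maj b j

/-- The Majorana operators of the sector with boundary twist `(-1) ^ δ`. -/
noncomputable def majMode (N δ : ℕ) (b : Bool) (m : ℕ) : Op N := majK N b (momentum N δ m)

theorem maj_anticommutator (b c : Bool) (i j : Fin N) :
    maj b i * maj c j + maj c j * maj b i = if b = c ∧ i = j then 2 else 0 := by
  split_ifs with h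
  · obtain ⟨rfl, rfl⟩ := h
    rw [maj_mul_self, one_add_one_eq_two]
  · rw [maj_anticomm (x := (b, i)) (y := (c, j)) (by simpa using h), neg_add_cancel]

theorem majMode_anticommutator (N δ : ℕ) [NeZero N] (b c : Bool) {m m' : ℕ} (hm : m < N)
    (hm' : m' < N) : majMode N δ b m * majMode N δ c m' + majMode N δ c m' * majMode N δ b m =
      if b = c ∧ m = m' then 2 else 0 := by
  have h1 : majMode N δ b m * majMode N δ c m' + majMode N δ c m' * majMode N δ b m =
      ∑ i, ∑ j, ((hartley N (momentum N δ m) i * hartley N (momentum N δ m') j : ℝ) : ℂ) •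
        (maj b i * maj c j + maj c j * maj b i) := by
    simp only [majMode, majK, Finset.sum_mul_sum, smul_mul_smul_comm, smul_add,
      Finset.sum_add_distrib]
    congr 1
    · push_cast; rfl
    · rw [Finset.sum_comm]
      push_cast
      simp only [mul_comm]
  have hs := hartley_orthonormal N δ hm hm'
  rw [h1]
  simp only [maj_anticommutator]
  by_cases hbc : b = c
  · simp only [hbc, true_and, smul_ite, smul_zero, Finset.sum_ite_eq, Finset.mem_univ, if_true]
    rw [← Finset.sum_smul, ← Complex.ofReal_sum, hs]
    split_ifs <;> simp
  · simp [hbc]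

/-- Hermiticity is what a real transform buys over the Fourier transform; the anticommutation
relations survive because it is orthogonal. -/
theorem isMajorana_majMode (N δ : ℕ) [NeZero N] : IsMajorana N (majMode N δ) where
  isHermitian b m _ := by
    rw [Matrix.IsHermitian, majMode, majK, Matrix.conjTranspose_sum]
    exact Finset.sum_congr rfl fun j _ => (real_smul_isHermitian (maj_isHermitian b j) _).eq
  mul_self b m hm := by
    have h := majMode_anticommutator N δ b b hm hm
    rw [if_pos ⟨rfl, rfl⟩, ← two_smul ℂ, ← one_add_one_eq_two (R := Op N), ← two_smul ℂ (1 : Op N)]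
      at h
    exact smul_right_injective _ (two_ne_zero (α := ℂ)) h
  anticomm b c m hm m' hm' h := by
    refine eq_neg_of_add_eq_zero_left ?_
    rw [majMode_anticommutator N δ b c hm hm', if_neg]
    simpa using h

theorem maj_eq_sum_majMode (N δ : ℕ) [NeZero N] (b : Bool) (j : Fin N) :
    maj b j = ∑ m ∈ Finset.range N,
      (hartley N (momentum N δ m) j : ℂ) • majMode N δ b m := by
  simp only [majMode, majK, Finset.smul_sum, smul_smul]
  rw [Finset.sum_comm]
  simp only [← Finset.sum_smul]
  have : ∀ l, ∑ m ∈ Finset.range N, (hartley N (momentum N δ m) j : ℂ) *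
      (hartley N (momentum N δ m) l : ℂ) = if j = l then 1 else 0 := fun l => by
    have := hartley_complete N δ j l
    rw [← Complex.ofReal_one, ← Complex.ofReal_zero, ← apply_ite, ← this]
    push_cast; rfl
  simp [this]

/-- Only one factor is expanded; the coefficients then reassemble the momentum operator in the
other. The two bond sums below use the same device. -/
theorem sum_maj_mul_maj (N δ : ℕ) [NeZero N] :
    ∑ j : Fin N, maj true j * maj false j =
      ∑ m ∈ Finset.range N, majMode N δ true m * majMode N δ false m := by
  simp only [maj_eq_sum_majMode N δ false, Finset.mul_sum, mul_smul_comm]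
  rw [Finset.sum_comm]
  refine Finset.sum_congr rfl fun m _ => ?_
  rw [majMode.eq_def N δ true, majK, Finset.sum_mul]
  simp only [smul_mul_assoc]

theorem sum_smul_maj_shift (N δ m : ℕ) [NeZero N] (b : Bool) :
    ∑ j : Fin N, ((twist δ j * hartley N (momentum N δ m) (j + 1) : ℝ) : ℂ) • maj b j =
      (Real.cos (momentum N δ m) : ℂ) • majMode N δ b m +
        (Real.sin (momentum N δ m) : ℂ) • majK N b (-momentum N δ m) := by
  simp only [hartley_shift, majMode, majK, Finset.smul_sum, ← Finset.sum_add_distrib, smul_smul]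
  refine Finset.sum_congr rfl fun j _ => ?_
  rw [← add_smul]
  push_cast
  rfl

theorem sum_maj_mul_maj_succ (N δ : ℕ) [NeZero N] :
    ∑ j : Fin N, (twist δ j : ℂ) • (maj true j * maj false (j + 1)) =
      ∑ m ∈ Finset.range N, ((Real.cos (momentum N δ m) : ℂ) • majMode N δ true m +
        (Real.sin (momentum N δ m) : ℂ) • majK N true (-momentum N δ m)) * majMode N δ false m := by
  simp only [maj_eq_sum_majMode N δ false, Finset.mul_sum, mul_smul_comm, Finset.smul_sum]
  rw [Finset.sum_comm]
  refine Finset.sum_congr rfl fun m _ => ?_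
  rw [← sum_smul_maj_shift, Finset.sum_mul]
  refine Finset.sum_congr rfl fun j _ => ?_
  rw [smul_smul, smul_mul_assoc]
  push_cast
  rfl

theorem sum_maj_succ_mul_maj (N δ : ℕ) [NeZero N] :
    ∑ j : Fin N, (twist δ j : ℂ) • (maj true (j + 1) * maj false j) =
      ∑ m ∈ Finset.range N, majMode N δ true m * ((Real.cos (momentum N δ m) : ℂ) •
        majMode N δ false m +
        (Real.sin (momentum N δ m) : ℂ) • majK N false (-momentum N δ m)) := by
  simp only [maj_eq_sum_majMode N δ true, Finset.sum_mul, smul_mul_assoc, Finset.smul_sum]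
  rw [Finset.sum_comm]
  refine Finset.sum_congr rfl fun m _ => ?_
  rw [← sum_smul_maj_shift, Finset.mul_sum]
  refine Finset.sum_congr rfl fun j _ => ?_
  rw [smul_smul, mul_smul_comm]
  push_cast
  rfl

end Fourier

/-! ### Parity sectors and their momentum Hamiltonians -/

section Sector

variable {N : ℕ}

/-- The quadratic Hamiltonian with boundary twist `(-1) ^ δ`. -/
noncomputable def sectorH (N : ℕ) [NeZero N] (δ : ℕ) (γ g : ℝ) : Op N :=
  Complex.I • ((((1 + γ) / 2 : ℝ) : ℂ) •
      ∑ j : Fin N, (twist δ j : ℂ) • (maj true j * maj false (j + 1)) +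
    (((1 - γ) / 2 : ℝ) : ℂ) • ∑ j : Fin N, (twist δ j : ℂ) • (maj true (j + 1) * maj false j) -
    (g : ℂ) • ∑ j : Fin N, maj true j * maj false j)

/-- The projection onto the sector of parity `-(-1) ^ δ`. -/
noncomputable def sectorProj (N δ : ℕ) : Op N :=
  (1 / 2 : ℂ) • (1 - ((-1) ^ δ : ℂ) • parity N)

theorem parity_commute_maj_mul_maj (b c : Bool) (i j : Fin N) :
    Commute (parity N) (maj b i * maj c j) :=
  (mul_commute_of_anticomm (by rw [parity_maj, neg_neg]) (by rw [parity_maj, neg_neg])).symm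

theorem sectorProj_commute {δ : ℕ} {x : Op N} (h : Commute (parity N) x) :
    Commute (sectorProj N δ) x :=
  ((Commute.one_left x).sub_left (h.smul_left _)).smul_left _

theorem parity_mul_sectorProj (δ : ℕ) :
    parity N * sectorProj N δ = (-(-1) ^ δ : ℂ) • sectorProj N δ := by
  have h : ((-1) ^ δ * (-1) ^ δ : ℂ) = 1 := by rw [← mul_pow]; simp
  rw [sectorProj, mul_smul_comm, mul_sub, mul_smul_comm, parity_mul_self, mul_one]
  match_scalars
  · linear_combination (-1 / 2 : ℂ) * h
  · ring

/-- On the sector, `P` is the scalar `-(-1) ^ δ`, so the factor `-P` of the closing bond becomes the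
twist `(-1) ^ δ`. -/
theorem bondSign_mul_sectorProj [NeZero N] (δ : ℕ) (j : Fin N) (x : Op N)
    (hx : Commute (parity N) x) :
    bondSign j * x * sectorProj N δ = ((twist δ j : ℂ) • x) * sectorProj N δ := by
  rw [bondSign, twist]
  split_ifs with h
  · rw [neg_mul, hx.eq, neg_mul, mul_assoc, parity_mul_sectorProj, mul_smul_comm, smul_mul_assoc]
    push_cast
    module
  · simp

theorem hamiltonian_mul_sectorProj [NeZero N] (hN : 2 ≤ N) (δ : ℕ) (γ g : ℝ) :
    hamiltonian N γ g * sectorProj N δ = sectorH N δ γ g * sectorProj N δ := by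
  rw [hamiltonian, sectorH]
  simp only [site_pauliX_bond hN, site_pauliY_bond hN, site_pauliZ_eq, sub_mul, neg_mul, add_mul,
    smul_mul_assoc, Finset.sum_mul, Finset.sum_add_distrib, ← Finset.smul_sum,
    bondSign_mul_sectorProj δ _ _ (parity_commute_maj_mul_maj _ _ _ _)]
  module

theorem sectorH_commute_parity [NeZero N] (δ : ℕ) (γ g : ℝ) :
    Commute (parity N) (sectorH N δ γ g) := by
  refine Commute.smul_right (Commute.sub_right (Commute.add_right ?_ ?_) ?_) _ <;>
    refine Commute.smul_right (Commute.sum_right _ _ _ fun j _ => ?_) _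
  · exact (parity_commute_maj_mul_maj _ _ _ _).smul_right _
  · exact (parity_commute_maj_mul_maj _ _ _ _).smul_right _
  · exact parity_commute_maj_mul_maj _ _ _ _

/-- The contribution of one momentum to `sectorH`. -/
noncomputable def modeH (N δ : ℕ) (γ g : ℝ) (m : ℕ) : Op N :=
  Complex.I • ((((1 + γ) / 2 : ℝ) : ℂ) •
      (((Real.cos (momentum N δ m) : ℂ) • majMode N δ true m +
        (Real.sin (momentum N δ m) : ℂ) • majK N true (-momentum N δ m)) * majMode N δ false m) +
    (((1 - γ) / 2 : ℝ) : ℂ) •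
      (majMode N δ true m * ((Real.cos (momentum N δ m) : ℂ) • majMode N δ false m +
        (Real.sin (momentum N δ m) : ℂ) • majK N false (-momentum N δ m))) -
    (g : ℂ) • (majMode N δ true m * majMode N δ false m))

theorem sectorH_eq_sum [NeZero N] (δ : ℕ) (γ g : ℝ) :
    sectorH N δ γ g = ∑ m ∈ Finset.range N, modeH N δ γ g m := by
  simp only [sectorH, modeH, sum_maj_mul_maj_succ, sum_maj_succ_mul_maj, sum_maj_mul_maj N δ,
    ← Finset.smul_sum, Finset.sum_add_distrib, Finset.sum_sub_distrib]

theorem sum_site_pauliZ [NeZero N] (δ : ℕ) :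
    ∑ j : Fin N, site pauliZ j =
    ∑ m ∈ Finset.range N, Complex.I • (majMode N δ true m * majMode N δ false m) := by
  simp only [site_pauliZ_eq, ← Finset.smul_sum, sum_maj_mul_maj N δ]

theorem majK_two_pi_sub (b : Bool) (k : ℝ) : majK N b (2 * Real.pi - k) = majK N b (-k) := by
  simp only [majK, hartley_two_pi_sub]

/-- The operator at momentum `-k` is the mode at `2π - k`, since positions are integers. The two
summands therefore close on one pair, the anisotropy surviving only in the transverse component. -/
theorem modeH_pair {δ m m' : ℕ} (h : momentum N δ m' = 2 * Real.pi - momentum N δ m) (γ g : ℝ) :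
    modeH N δ γ g m + modeH N δ γ g m' =
      (2 * (Real.cos (momentum N δ m) - g) : ℂ) • pairZ (majMode N δ) m m' +
        (2 * (γ * Real.sin (momentum N δ m)) : ℂ) • pairX (majMode N δ) m m' := by
  have h1 : ∀ b, majK N b (-momentum N δ m) = majMode N δ b m' := fun b => by
    rw [majMode, h, majK_two_pi_sub]
  have h2 : ∀ b, majK N b (-momentum N δ m') = majMode N δ b m := fun b => by
    rw [majMode, ← majK_two_pi_sub, h, sub_sub_cancel]
  rw [modeH, modeH]
  simp only [h1, h2]
  simp only [h, Real.cos_two_pi_sub, Real.sin_two_pi_sub, pairZ, pairX, add_mul, mul_add,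
    smul_mul_assoc, mul_smul_comm]
  push_cast
  module

theorem modeH_single {δ m : ℕ} (h : Real.sin (momentum N δ m) = 0) (γ g : ℝ) :
    modeH N δ γ g m = (Real.cos (momentum N δ m) - g : ℂ) •
      (Complex.I • (majMode N δ true m * majMode N δ false m)) := by
  rw [modeH, h]
  simp only [add_mul, mul_add, smul_mul_assoc, mul_smul_comm]
  push_cast
  module

/-- Sitewise, `exp(-iπσ^z/2) = -iσ^z`. This makes the parity a function of the magnetization, whose
form is the same in position and momentum space. -/
theorem exp_sum_site_pauliZ :
    NormedSpace.exp ((-(Real.pi / 2 * Complex.I)) • ∑ j : Fin N, site pauliZ j) =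
      (-Complex.I) ^ N • parity N := by
  have hsq : ∀ j : Fin N, site pauliZ j * site pauliZ j = 1 := fun j => by
    rw [site_mul_site_same, pauliZ_mul_self, site_eq_tens]
    simp only [ite_self, tens_one]
  have h1 : (-(Real.pi / 2 * Complex.I)) • ∑ j : Fin N, site pauliZ j =
      ((List.finRange N).map fun j => (-(Real.pi / 2 * Complex.I)) • site pauliZ j).sum := by
    rw [Finset.smul_sum, ← List.ofFn_eq_map, List.sum_ofFn]
  rw [h1, exp_sum_map (r := fun i j : Fin N => i ≠ j) (List.nodup_finRange N)
    fun i j hij => ((site_commute pauliZ pauliZ hij).smul_left _).smul_right _]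
  have h2 : ∀ j : Fin N, NormedSpace.exp ((-(Real.pi / 2 * Complex.I)) • site pauliZ j) =
      (-Complex.I) • site pauliZ j := fun j => by
    rw [exp_smul_of_sq_eq_idempotent (one_mul 1) (hsq j) (one_mul _) (mul_one _),
      Complex.cosh_neg, Complex.sinh_neg, Complex.cosh_mul_I, Complex.sinh_mul_I,
      Complex.cos_pi_div_two, Complex.sin_pi_div_two]
    module
  simp only [h2]
  rw [prod_map_smul, parity, List.ofFn_eq_map]
  simp

theorem sq_add_sq_uv (p q : Params) (θ η : ℝ → ℝ) (k : ℝ) :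
    u p q θ η k ^ 2 + v p q θ η k ^ 2 =
      2 * (Real.cosh (2 * (p.β * energy p.γ p.g k)) * Real.cosh (2 * (q.β * energy q.γ q.g k)) +
        Real.sinh (2 * (p.β * energy p.γ p.g k)) * Real.sinh (2 * (q.β * energy q.γ q.g k)) *
          Real.cos (θ k - η k)) + 2 := by
  rw [u, v]
  set a := p.β * energy p.γ p.g k
  set b := q.β * energy q.γ q.g k
  have h1 : Real.cos (θ k - η k) = 2 * Real.cos ((θ k - η k) / 2) ^ 2 - 1 := by
    rw [← Real.cos_two_mul]; ring_nf
  have h2 : Real.sin ((θ k - η k) / 2) ^ 2 = 1 - Real.cos ((θ k - η k) / 2) ^ 2 := by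
    rw [Real.sin_sq]
  have ha := Real.cosh_sq a
  have hb := Real.cosh_sq b
  rw [h1, mul_pow _ (Real.sin _), h2, Real.cosh_add, Real.cosh_sub, Real.cosh_two_mul,
    Real.cosh_two_mul, Real.sinh_two_mul, Real.sinh_two_mul]
  ring_nf
  rw [ha, hb]
  ring

/-- Supplies the positivity of `r` by which the root is divided; it follows from `cosh ≥ 1` and
`cos² + sin² = 1`. -/
theorem two_le_sqrt_uv (p q : Params) (θ η : ℝ → ℝ) (k : ℝ) :
    2 ≤ √(u p q θ η k ^ 2 + v p q θ η k ^ 2) := by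
  refine Real.le_sqrt_of_sq_le ?_
  rw [u, v, mul_pow, mul_pow, mul_pow, mul_pow]
  have h1 := Real.one_le_cosh (p.β * energy p.γ p.g k + q.β * energy q.γ q.g k)
  have h2 := Real.one_le_cosh (p.β * energy p.γ p.g k - q.β * energy q.γ q.g k)
  have h3 := Real.cos_sq_add_sin_sq ((θ k - η k) / 2)
  have h4 := mul_le_mul_of_nonneg_right (one_le_pow₀ h1 (n := 2))
    (sq_nonneg (Real.cos ((θ k - η k) / 2)))
  have h5 := mul_le_mul_of_nonneg_right (one_le_pow₀ h2 (n := 2))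
    (sq_nonneg (Real.sin ((θ k - η k) / 2)))
  linarith

theorem exists_momentum_pairBlock [NeZero N] {δ m m' : ℕ} (hm : m < N) (hm' : m' < N) (hne : m ≠ m')
    (h : momentum N δ m' = 2 * Real.pi - momentum N δ m) (p q : Params) (θ η : ℝ → ℝ)
    (hθ : IsBogoliubovAngle p.γ p.g (momentum N δ m) (θ (momentum N δ m)))
    (hη : IsBogoliubovAngle q.γ q.g (momentum N δ m) (η (momentum N δ m))) :
    ∃ B : Block (majMode N δ), B.idx = {m, m'} ∧
      B.hp = (-(p.β / 2) : ℂ) • (modeH N δ p.γ p.g m + modeH N δ p.γ p.g m') ∧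
      B.hq = (-q.β : ℂ) • (modeH N δ q.γ q.g m + modeH N δ q.γ q.g m') ∧
      B.nz = Complex.I • (majMode N δ true m * majMode N δ false m) +
        Complex.I • (majMode N δ true m' * majMode N δ false m') ∧ B.κ = -1 ∧
      B.tp = ((√(u p q θ η (momentum N δ m) ^ 2 + v p q θ η (momentum N δ m) ^ 2) : ℝ) + 2) / 4 ∧
      B.tm =
        ((√(u p q θ η (momentum N δ m) ^ 2 + v p q θ η (momentum N δ m) ^ 2) : ℝ) - 2) / 4 := by
  have hr0 := two_le_sqrt_uv p q θ η (momentum N δ m)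
  -- Unification with `sq_add_sq_uv` fixes `a` and `b` as the products `β ε` of the two states and
  -- `φ`, `ψ` as their Bogoliubov angles. The angles are used below only in the form multiplied by
  -- `ε`, so `ε = 0` needs no separate case.
  obtain ⟨B, h1, h2, h3, h4, h5, h6, h7⟩ := (isMajorana_majMode N δ).exists_pairBlock hm hm' hne
    (lt_of_lt_of_le two_pos hr0)
    ((Real.sq_sqrt (add_nonneg (sq_nonneg _) (sq_nonneg _))).trans (sq_add_sq_uv p q θ η _))
  refine ⟨B, h1, ?_, ?_, ?_, h5, h6, h7⟩
  · rw [h2, modeH_pair h]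
    have e1 := congrArg (fun x : ℝ => (x : ℂ)) hθ.1
    have e2 := congrArg (fun x : ℝ => (x : ℂ)) hθ.2
    push_cast at e1 e2 ⊢
    match_scalars
    · linear_combination (p.β : ℂ) * e2
    · linear_combination -(p.β : ℂ) * e1
  · rw [h3, modeH_pair h]
    have e1 := congrArg (fun x : ℝ => (x : ℂ)) hη.1
    have e2 := congrArg (fun x : ℝ => (x : ℂ)) hη.2
    push_cast at e1 e2 ⊢
    match_scalars
    · linear_combination 2 * (q.β : ℂ) * e2
    · linear_combination -2 * (q.β : ℂ) * e1
  · rw [h4, pairZ]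
    module

theorem exists_momentum_singleBlock [NeZero N] {δ m : ℕ} (hm : m < N)
    (hs : Real.sin (momentum N δ m) = 0) (p q : Params) {ε ε' : ℝ}
    (hε : p.g - Real.cos (momentum N δ m) = ε)
    (hε' : q.g - Real.cos (momentum N δ m) = ε') :
    ∃ B : Block (majMode N δ), B.idx = {m} ∧
      B.hp = (-(p.β / 2) : ℂ) • modeH N δ p.γ p.g m ∧
      B.hq = (-q.β : ℂ) • modeH N δ q.γ q.g m ∧
      B.nz = Complex.I • (majMode N δ true m * majMode N δ false m) ∧ B.κ = -Complex.I ∧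
      B.tp = Real.cosh ((p.β * ε + q.β * ε') / 2) ∧
      B.tm = Real.sinh ((p.β * ε + q.β * ε') / 2) := by
  obtain ⟨B, h1, h2, h3, h4, h5, h6, h7⟩ := (isMajorana_majMode N δ).exists_singleBlock hm
    (p.β * ε / 2) (q.β * ε' / 2)
  refine ⟨B, h1, ?_, ?_, h4, h5, ?_, ?_⟩
  · rw [h2, modeH_single hs, ← hε]
    push_cast
    module
  · rw [h3, modeH_single hs, ← hε']
    push_cast
    module
  · rw [h6]; ring_nf
  · rw [h7]; ring_nf

end Sector

/-! ### Each parity sector as a list of independent momentum blocks -/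

section SectorBlocks

theorem sum_range_eq_sum_reflected_pairs {A : Type*} [AddCommMonoid A] {N M : ℕ} (hM : N = 2 * M)
    (F : ℕ → A) : ∑ m ∈ Finset.range N, F m = ∑ j : Fin M, (F j + F (N - 1 - j)) := by
  rw [hM, two_mul, Finset.sum_range_add, ← Finset.sum_range_reflect (fun x => F (M + x)),
    ← Finset.sum_add_distrib, Finset.sum_range]
  refine Finset.sum_congr rfl fun j _ => ?_
  have hj := j.isLt
  congr 2
  omega

/-- The involution `m ↦ -m` modulo `N` has the fixed points `0` and `N / 2 = M + 1`, the momenta `0`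
and `π` of the periodic sector. -/
theorem sum_range_eq_sum_negated_pairs {A : Type*} [AddCommMonoid A] {N M : ℕ}
    (hM : N = 2 * (M + 1)) (F : ℕ → A) :
    ∑ m ∈ Finset.range N, F m =
      F 0 + (F (M + 1) + ∑ j : Fin M, (F (j + 1) + F (N - (j + 1)))) := by
  rw [hM, show 2 * (M + 1) = (M + (M + 1)) + 1 by ring, Finset.sum_range_succ',
    Finset.sum_range_add, Finset.sum_range_succ' (fun x => F (M + x + 1)),
    ← Finset.sum_range_reflect (fun x => F (M + (x + 1) + 1)), Finset.sum_add_distrib,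
    Finset.sum_range, Finset.sum_range]
  have h : ∑ j : Fin M, F (M + (M - 1 - j + 1) + 1) = ∑ j : Fin M, F (M + (M + 1) + 1 - (j + 1)) :=
    Finset.sum_congr rfl fun j _ => by
      have hj := j.isLt
      congr 1
      omega
  rw [h, add_zero]
  abel

variable {N : ℕ}

theorem momentum_injective (N δ : ℕ) [NeZero N] : Function.Injective (momentum N δ) := by
  intro i j h
  have hN : (N : ℝ) ≠ 0 := Nat.cast_ne_zero.mpr (NeZero.ne N)
  rw [momentum, momentum, div_left_inj' hN, mul_left_inj' Real.pi_ne_zero, add_left_inj] at h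
  exact_mod_cast mul_left_cancel₀ two_ne_zero h

theorem kPlus_eq {M : ℕ} (hM : N = 2 * M) :
    kPlus N = (Finset.range M).image (momentum N 1) := by
  rw [kPlus, show N / 2 = M by omega]
  refine Finset.image_congr fun j _ => ?_
  simp [momentum]

theorem kMinus_eq {M : ℕ} (hM : N = 2 * (M + 1)) :
    kMinus N = (Finset.range M).image fun j => momentum N 0 (j + 1) := by
  rw [kMinus, show N / 2 = M + 1 by omega, Finset.range_eq_Ico, ← Finset.image_add_right_Ico 0 M 1,
    Finset.image_image]
  refine Finset.image_congr fun j _ => ?_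
  simp [momentum]

theorem prod_kPlus [NeZero N] {M : ℕ} (hM : N = 2 * M) (f : ℝ → ℝ) :
    ∏ k ∈ kPlus N, f k = ∏ j : Fin M, f (momentum N 1 j) := by
  rw [kPlus_eq hM, Finset.prod_image (momentum_injective N 1).injOn, Finset.prod_range]

theorem prod_kMinus [NeZero N] {M : ℕ} (hM : N = 2 * (M + 1)) (f : ℝ → ℝ) :
    ∏ k ∈ kMinus N, f k = ∏ j : Fin M, f (momentum N 0 (j + 1)) := by
  rw [kMinus_eq hM, Finset.prod_image, Finset.prod_range]
  exact ((momentum_injective N 0).comp (add_left_injective 1)).injOn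

/-- A decomposition of a parity sector into independent blocks, together with the traces of
the resulting square root `S` and of `P * S`. -/
structure SectorDecomp (N : ℕ) [NeZero N] (δ : ℕ) (p q : Params) (x y : ℝ) where
  /-- the blocks -/
  L : List (Block (majMode N δ))
  indep : L.Pairwise Block.Indep
  sum_hp : (L.map Block.hp).sum = (-(p.β / 2) : ℂ) • sectorH N δ p.γ p.g
  sum_hq : (L.map Block.hq).sum = (-q.β : ℂ) • sectorH N δ q.γ q.g
  prodP_eq : Block.prodP L = parity N
  trace_prodS : (Block.prodS L).trace = x
  trace_parity_prodS : (parity N * Block.prodS L).trace = y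

theorem indep_of_disjoint [NeZero N] {δ : ℕ} {X Y : Block (majMode N δ)}
    (hX : ∀ i ∈ X.idx, i < N) (hY : ∀ i ∈ Y.idx, i < N) (h : Disjoint X.idx Y.idx) :
    X.Indep Y := fun b c i hi j hj =>
  (isMajorana_majMode N δ).anticomm b c i (hX i hi) j (hY j hj) fun he =>
    Set.disjoint_left.mp h hi (by rw [(Prod.mk.inj he).2]; exact hj)

theorem card_config (N : ℕ) : (Fintype.card (Config N) : ℂ) = 2 ^ N := by simp

/-- Both sides arise from exponentiating the same total magnetization, by sites and by blocks;
equality of the phases then gives equality of the parities. This settles the overall sign without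
computing a determinant of the Hartley transform. -/
theorem prodP_eq_parity [NeZero N] {δ : ℕ} {L : List (Block (majMode N δ))}
    (hL : L.Pairwise Block.Indep)
    (hnz : (L.map Block.nz).sum =
      ∑ m ∈ Finset.range N, Complex.I • (majMode N δ true m * majMode N δ false m))
    (hκ : (L.map Block.κ).prod = (-Complex.I) ^ N) : Block.prodP L = parity N := by
  have h := Block.exp_sum_nz hL
  rw [hnz, ← sum_site_pauliZ, exp_sum_site_pauliZ, hκ] at h
  exact (smul_right_injective _ (pow_ne_zero N (neg_ne_zero.mpr Complex.I_ne_zero)) h).symm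

theorem four_pow_mul_prod_div (M : ℕ) (f : Fin M → ℝ) :
    (∏ j, f j / 4) * 4 ^ M = ∏ j, f j := by
  rw [Finset.prod_div_distrib, Finset.prod_const, Finset.card_univ, Fintype.card_fin,
    div_mul_cancel₀ _ (pow_ne_zero M four_ne_zero)]

theorem exists_sectorDecomp_plus [NeZero N] (hN : Even N) (p q : Params) (θ η : ℝ → ℝ)
    (hθ : ∀ k ∈ kPlus N, IsBogoliubovAngle p.γ p.g k (θ k))
    (hη : ∀ k ∈ kPlus N, IsBogoliubovAngle q.γ q.g k (η k)) :
    Nonempty (SectorDecomp N 1 p q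
      (∏ k ∈ kPlus N, (√(u p q θ η k ^ 2 + v p q θ η k ^ 2) + 2))
      (∏ k ∈ kPlus N, (√(u p q θ η k ^ 2 + v p q θ η k ^ 2) - 2))) := by
  obtain ⟨M, hM⟩ := hN.two_dvd
  have hN0 : (N : ℝ) ≠ 0 := Nat.cast_ne_zero.mpr (NeZero.ne N)
  have hI : (-Complex.I) ^ N = (-1) ^ M := by rw [hM, pow_mul, neg_sq, Complex.I_sq]
  have h2N : (2 : ℂ) ^ N = 4 ^ M := by rw [hM, pow_mul]; norm_num
  have hk : ∀ j : Fin M, momentum N 1 j ∈ kPlus N := fun j => by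
    rw [kPlus_eq hM]
    exact Finset.mem_image_of_mem _ (Finset.mem_range.mpr j.isLt)
  have hm : ∀ j : Fin M, momentum N 1 (N - 1 - j) = 2 * Real.pi - momentum N 1 j := fun j => by
    have hj := j.isLt
    rw [momentum, momentum, Nat.sub_sub, Nat.cast_sub (by omega)]
    push_cast
    field_simp
    ring
  have hB := fun j : Fin M => exists_momentum_pairBlock (N := N) (δ := 1) (m := j)
    (m' := N - 1 - j) (by omega) (by omega) (by omega) (hm j) p q θ η
    (hθ _ (hk j)) (hη _ (hk j))
  choose B h1 h2 h3 h4 h5 h6 h7 using hB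
  have hindep : (List.ofFn B).Pairwise Block.Indep := by
    refine List.pairwise_ofFn.mpr fun i j hij => indep_of_disjoint ?_ ?_ ?_
    · rw [h1]; rintro k (rfl | rfl) <;> omega
    · rw [h1]; rintro k (rfl | rfl) <;> omega
    · rw [h1, h1, Set.disjoint_left]
      have := Fin.lt_def.mp hij
      rintro k (rfl | rfl) (h | h) <;> (try rw [Set.mem_singleton_iff] at h) <;> omega
  have hP : Block.prodP (List.ofFn B) = parity N := by
    refine prodP_eq_parity hindep ?_ ?_
    · rw [List.map_ofFn, List.sum_ofFn, sum_range_eq_sum_reflected_pairs hM]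
      exact Finset.sum_congr rfl fun j _ => h4 j
    · rw [List.map_ofFn, List.prod_ofFn, hI]
      simp [h5]
  refine ⟨⟨List.ofFn B, hindep, ?_, ?_, hP, ?_, ?_⟩⟩
  · rw [List.map_ofFn, List.sum_ofFn, sectorH_eq_sum, sum_range_eq_sum_reflected_pairs hM,
      Finset.smul_sum]
    exact Finset.sum_congr rfl fun j _ => h2 j
  · rw [List.map_ofFn, List.sum_ofFn, sectorH_eq_sum, sum_range_eq_sum_reflected_pairs hM,
      Finset.smul_sum]
    exact Finset.sum_congr rfl fun j _ => h3 j
  · rw [Block.trace_prodS hindep, List.map_ofFn, List.prod_ofFn, card_config, prod_kPlus hM,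
      ← four_pow_mul_prod_div]
    simp only [Function.comp, h6, h2N]
    push_cast
    rfl
  · rw [← hP, Block.trace_prodP_mul_prodS hindep, List.map_ofFn, List.prod_ofFn, card_config,
      prod_kPlus hM, ← four_pow_mul_prod_div]
    simp only [Function.comp, h7, h2N]
    push_cast
    rfl

theorem exists_sectorDecomp_minus [NeZero N] (hN : Even N) (p q : Params) (θ η : ℝ → ℝ)
    (hθ : ∀ k ∈ kMinus N, IsBogoliubovAngle p.γ p.g k (θ k))
    (hη : ∀ k ∈ kMinus N, IsBogoliubovAngle q.γ q.g k (η k)) :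
    Nonempty (SectorDecomp N 0 p q
      (4 * Real.cosh ((p.β * energy p.γ p.g 0 + q.β * energy q.γ q.g 0) / 2)
        * Real.cosh ((p.β * energy p.γ p.g Real.pi + q.β * energy q.γ q.g Real.pi) / 2)
        * ∏ k ∈ kMinus N, (√(u p q θ η k ^ 2 + v p q θ η k ^ 2) + 2))
      (4 * Real.sinh ((p.β * energy p.γ p.g 0 + q.β * energy q.γ q.g 0) / 2)
        * Real.sinh ((p.β * energy p.γ p.g Real.pi + q.β * energy q.γ q.g Real.pi) / 2)
        * ∏ k ∈ kMinus N, (√(u p q θ η k ^ 2 + v p q θ η k ^ 2) - 2))) := by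
  obtain ⟨M, hM⟩ : ∃ M, N = 2 * (M + 1) := by
    obtain ⟨M, hM⟩ := hN.two_dvd
    have := NeZero.ne N
    exact ⟨M - 1, by omega⟩
  have hN0 : (N : ℝ) ≠ 0 := Nat.cast_ne_zero.mpr (NeZero.ne N)
  have hI : (-Complex.I) ^ N = (-1) ^ (M + 1) := by rw [hM, pow_mul, neg_sq, Complex.I_sq]
  have h2N : (2 : ℂ) ^ N = 4 ^ (M + 1) := by rw [hM, pow_mul]; norm_num
  have hk : ∀ j : Fin M, momentum N 0 (j + 1) ∈ kMinus N := fun j => by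
    rw [kMinus_eq hM]
    exact Finset.mem_image_of_mem (fun j => momentum N 0 (j + 1)) (Finset.mem_range.mpr j.isLt)
  have hm : ∀ j : Fin M, momentum N 0 (N - (j + 1)) = 2 * Real.pi - momentum N 0 (j + 1) :=
    fun j => by
      have hj := j.isLt
      rw [momentum, momentum, Nat.cast_sub (by omega)]
      push_cast
      field_simp
      ring
  have hB := fun j : Fin M => exists_momentum_pairBlock (N := N) (δ := 0) (m := j + 1)
    (m' := N - (j + 1)) (by omega) (by omega) (by omega) (hm j) p q θ η
    (hθ _ (hk j)) (hη _ (hk j))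
  choose B h1 h2 h3 h4 h5 h6 h7 using hB
  have hm0 : momentum N 0 0 = 0 := by simp [momentum]
  have hmpi : momentum N 0 (M + 1) = Real.pi := by
    rw [momentum, div_eq_iff hN0, hM]; push_cast; ring
  obtain ⟨Z, z1, z2, z3, z4, z5, z6, z7⟩ := exists_momentum_singleBlock (N := N) (δ := 0) (m := 0)
    (by omega) (by rw [hm0, Real.sin_zero]) p q (ε := energy p.γ p.g 0) (ε' := energy q.γ q.g 0)
    (by rw [hm0, Real.cos_zero, energy, if_pos rfl])
    (by rw [hm0, Real.cos_zero, energy, if_pos rfl])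
  obtain ⟨W, w1, w2, w3, w4, w5, w6, w7⟩ := exists_momentum_singleBlock (N := N) (δ := 0)
    (m := M + 1)
    (by omega) (by rw [hmpi, Real.sin_pi]) p q (ε := energy p.γ p.g Real.pi)
    (ε' := energy q.γ q.g Real.pi)
    (by rw [hmpi, Real.cos_pi, energy, if_neg Real.pi_ne_zero, if_pos rfl, sub_neg_eq_add])
    (by rw [hmpi, Real.cos_pi, energy, if_neg Real.pi_ne_zero, if_pos rfl, sub_neg_eq_add])
  have hZ : ∀ i ∈ Z.idx, i < N := by rw [z1]; rintro k rfl; omega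
  have hW : ∀ i ∈ W.idx, i < N := by rw [w1]; rintro k rfl; omega
  have hBi : ∀ j, ∀ i ∈ (B j).idx, i < N := fun j => by
    rw [h1]; rintro k (rfl | rfl) <;> omega
  have hindep : (Z :: W :: List.ofFn B).Pairwise Block.Indep := by
    rw [List.pairwise_cons, List.pairwise_cons]
    refine ⟨?_, ?_, List.pairwise_ofFn.mpr fun i j hij => indep_of_disjoint (hBi i) (hBi j) ?_⟩
    · intro Y hY
      rcases List.mem_cons.mp hY with rfl | hY
      · refine indep_of_disjoint hZ hW ?_
        rw [z1, w1, Set.disjoint_singleton]; omega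
      · obtain ⟨j, rfl⟩ := List.mem_ofFn.mp hY
        refine indep_of_disjoint hZ (hBi j) ?_
        rw [z1, h1, Set.disjoint_left]
        rintro k rfl (h | h) <;> (try rw [Set.mem_singleton_iff] at h) <;> omega
    · intro Y hY
      obtain ⟨j, rfl⟩ := List.mem_ofFn.mp hY
      refine indep_of_disjoint hW (hBi j) ?_
      rw [w1, h1, Set.disjoint_left]
      rintro k rfl (h | h) <;> (try rw [Set.mem_singleton_iff] at h) <;> omega
    · rw [h1, h1, Set.disjoint_left]
      have := Fin.lt_def.mp hij
      rintro k (rfl | rfl) (h | h) <;> (try rw [Set.mem_singleton_iff] at h) <;> omega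
  have hP : Block.prodP (Z :: W :: List.ofFn B) = parity N := by
    refine prodP_eq_parity hindep ?_ ?_
    · rw [List.map_cons, List.map_cons, List.sum_cons, List.sum_cons, List.map_ofFn, List.sum_ofFn,
        sum_range_eq_sum_negated_pairs hM, z4, w4]
      congr 2
      exact Finset.sum_congr rfl fun j _ => h4 j
    · rw [List.map_cons, List.map_cons, List.prod_cons, List.prod_cons, List.map_ofFn,
        List.prod_ofFn, hI, z5, w5, ← mul_assoc, neg_mul_neg, Complex.I_mul_I, pow_succ']
      simp [h5]
  refine ⟨⟨Z :: W :: List.ofFn B, hindep, ?_, ?_, hP, ?_, ?_⟩⟩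
  · rw [List.map_cons, List.map_cons, List.sum_cons, List.sum_cons, List.map_ofFn, List.sum_ofFn,
      sectorH_eq_sum, sum_range_eq_sum_negated_pairs hM, smul_add, smul_add,
      Finset.smul_sum, z2, w2]
    congr 2
    exact Finset.sum_congr rfl fun j _ => h2 j
  · rw [List.map_cons, List.map_cons, List.sum_cons, List.sum_cons, List.map_ofFn, List.sum_ofFn,
      sectorH_eq_sum, sum_range_eq_sum_negated_pairs hM, smul_add, smul_add,
      Finset.smul_sum, z3, w3]
    congr 2
    exact Finset.sum_congr rfl fun j _ => h3 j
  -- The `M` pairs use up `4 ^ M` of the dimension `4 ^ (M + 1)`; the remaining `4` belongs to the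
  -- two single modes.
  · rw [Block.trace_prodS hindep, List.map_cons, List.map_cons, List.prod_cons, List.prod_cons,
      List.map_ofFn, List.prod_ofFn, card_config, prod_kMinus hM, ← four_pow_mul_prod_div, z6, w6]
    simp only [Function.comp, h6, h2N]
    push_cast
    generalize ∏ j : Fin M, (_ : ℂ) = X
    ring
  · rw [← hP, Block.trace_prodP_mul_prodS hindep, List.map_cons, List.map_cons, List.prod_cons,
      List.prod_cons, List.map_ofFn, List.prod_ofFn, card_config, prod_kMinus hM,
      ← four_pow_mul_prod_div, z7, w7]
    simp only [Function.comp, h7, h2N]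
    push_cast
    generalize ∏ j : Fin M, (_ : ℂ) = X
    ring

end SectorBlocks

/-! ### The global positive square root -/

section Fidelity

open scoped MatrixOrder ComplexOrder

variable {N : ℕ}

theorem msqrt_eq {A S : Op N} (hS : S.PosSemidef) (h : S * S = A) : msqrt A = S :=
  CFC.sqrt_unique h (Matrix.nonneg_iff_posSemidef.mpr hS)

theorem posSemidef_of_sq {A S : Op N} (hS : S.IsHermitian) (h : S * S = A) : A.PosSemidef := by
  have := Matrix.posSemidef_conjTranspose_mul_self S
  rwa [hS.eq, h] at this

theorem exp_half_mul_self (X : Op N) :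
    NormedSpace.exp ((1 / 2 : ℂ) • X) * NormedSpace.exp ((1 / 2 : ℂ) • X) =
      NormedSpace.exp X := by
  rw [← Matrix.exp_add_of_commute _ _ (Commute.refl _), ← add_smul]
  norm_num

theorem exp_posSemidef {X : Op N} (hX : X.IsHermitian) : (NormedSpace.exp X).PosSemidef := by
  refine posSemidef_of_sq (S := NormedSpace.exp ((1 / 2 : ℂ) • X)) ?_ (exp_half_mul_self X)
  have := (real_smul_isHermitian hX (1 / 2)).exp
  push_cast at this
  exact this

theorem exp_posDef {X : Op N} (hX : X.IsHermitian) : (NormedSpace.exp X).PosDef :=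
  (exp_posSemidef hX).posDef_iff_isUnit.mpr (Matrix.isUnit_exp X)

theorem smul_posSemidef {S : Op N} (hS : S.PosSemidef) {c : ℝ} (hc : 0 ≤ c) :
    ((c : ℂ) • S).PosSemidef :=
  hS.smul (Complex.zero_le_real.mpr hc)

theorem fidelityOp_eq {A B R S : Op N} (hR : R.PosSemidef) (hRA : R * R = A) (hS : S.PosSemidef)
    (hSS : S * S = R * B * R) : fidelityOp A B = S := by
  rw [fidelityOp, msqrt_eq hR hRA, msqrt_eq hS hSS]

/-- Normalizing the two states rescales the known roots by `1/√a` and `1/√(ab)`, and uniqueness of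
positive roots applies again. -/
theorem fidelityOp_smul {A B R S : Op N} (hR : R.PosSemidef) (hRA : R * R = A) (hS : S.PosSemidef)
    (hSS : S * S = R * B * R) {a b : ℝ} (ha : 0 < a) (hb : 0 < b) :
    fidelityOp ((a : ℂ)⁻¹ • A) ((b : ℂ)⁻¹ • B) = ((√(a * b) : ℝ) : ℂ)⁻¹ • S := by
  have h : ∀ c : ℝ, 0 < c → ((√c : ℝ) : ℂ)⁻¹ * ((√c : ℝ) : ℂ)⁻¹ = (c : ℂ)⁻¹ := fun c hc => by
    rw [← mul_inv, ← Complex.ofReal_mul, Real.mul_self_sqrt hc.le]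
  refine fidelityOp_eq (R := ((√a : ℝ) : ℂ)⁻¹ • R) ?_ ?_ ?_ ?_
  · rw [← Complex.ofReal_inv]
    exact smul_posSemidef hR (by positivity)
  · rw [smul_mul_smul_comm, hRA, h a ha]
  · rw [← Complex.ofReal_inv]
    exact smul_posSemidef hS (by positivity)
  · rw [smul_mul_smul_comm, hSS, h _ (mul_pos ha hb), smul_mul_smul_comm, smul_mul_smul_comm,
      Complex.ofReal_mul]
    congr 1
    rw [mul_right_comm, h a ha, mul_inv]

theorem fidelityPlus_add_fidelityMinus (A B : Op N) :
    fidelityPlus A B + fidelityMinus A B = fidelity A B := by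
  rw [fidelityPlus, fidelityMinus, fidelity, ← Matrix.trace_add, ← add_mul]
  congr 1
  rw [show (1 / 2 : ℂ) • (1 + parity N) + (1 / 2 : ℂ) • (1 - parity N) = 1 by module, one_mul]

theorem hamiltonian_isHermitian [NeZero N] (hN : 2 ≤ N) (γ g : ℝ) :
    (hamiltonian N γ g).IsHermitian := by
  have hne : ∀ i : Fin N, i ≠ i + 1 := fun i h => by
    have h1 : (1 : Fin N) = 0 := by simpa using h.symm
    have := congrArg Fin.val h1
    rw [Fin.val_one', Fin.val_zero, Nat.mod_eq_of_lt (by omega)] at this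
    omega
  have hb : ∀ (A : Matrix (Fin 2) (Fin 2) ℂ), A.IsHermitian → ∀ i : Fin N,
      (site A i * site A (i + 1)).IsHermitian := fun A hA i => by
    rw [Matrix.IsHermitian, Matrix.conjTranspose_mul, (site_isHermitian hA _).eq,
      (site_isHermitian hA _).eq, (site_commute A A (hne i)).eq]
  rw [hamiltonian]
  refine (Matrix.IsHermitian.neg ?_).sub (real_smul_isHermitian ?_ g)
  · rw [Matrix.IsHermitian, Matrix.conjTranspose_sum]
    exact Finset.sum_congr rfl fun i _ =>
      ((real_smul_isHermitian (hb _ pauliX_isHermitian i) _).add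
        (real_smul_isHermitian (hb _ pauliY_isHermitian i) _)).eq
  · rw [Matrix.IsHermitian, Matrix.conjTranspose_sum]
    exact Finset.sum_congr rfl fun i _ => (site_isHermitian pauliZ_isHermitian i).eq

/-! ## Parity projections -/

theorem sectorProj_one : sectorProj N 1 = (1 / 2 : ℂ) • (1 + parity N) := by
  rw [sectorProj]; module

theorem sectorProj_zero : sectorProj N 0 = (1 / 2 : ℂ) • (1 - parity N) := by
  rw [sectorProj]; module

theorem sectorProj_isHermitian (δ : ℕ) : (sectorProj N δ).IsHermitian := by
  have h := real_smul_isHermitian ((Matrix.isHermitian_one).sub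
    (real_smul_isHermitian (parity_isHermitian (N := N)) ((-1) ^ δ))) (1 / 2)
  push_cast at h
  exact h

theorem sectorProj_mul_self (δ : ℕ) : sectorProj N δ * sectorProj N δ = sectorProj N δ := by
  have h : ((-1) ^ δ * (-1) ^ δ : ℂ) = 1 := by rw [← mul_pow]; simp
  rw [sectorProj.eq_def N δ, smul_mul_assoc, sub_mul, smul_mul_assoc, ← sectorProj,
    parity_mul_sectorProj, one_mul, smul_smul, mul_neg, h]
  module

theorem sectorProj_one_mul_zero : sectorProj N 1 * sectorProj N 0 = 0 := by
  rw [sectorProj_one, smul_mul_assoc, add_mul, parity_mul_sectorProj, one_mul]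
  module

theorem sectorProj_zero_mul_one : sectorProj N 0 * sectorProj N 1 = 0 := by
  rw [sectorProj_zero, smul_mul_assoc, sub_mul, parity_mul_sectorProj, one_mul]
  module

theorem sectorProj_add : sectorProj N 1 + sectorProj N 0 = 1 := by
  rw [sectorProj_one, sectorProj_zero]; module

theorem majMode_anticomm_parity (δ : ℕ) (b : Bool) (m : ℕ) :
    majMode N δ b m * parity N = -(parity N * majMode N δ b m) := by
  rw [majMode, majK, Finset.sum_mul, Finset.mul_sum, ← Finset.sum_neg_distrib]
  refine Finset.sum_congr rfl fun j _ => ?_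
  rw [smul_mul_assoc, mul_smul_comm, parity_maj, smul_neg, neg_neg]

namespace SectorDecomp

variable [NeZero N] {δ : ℕ} {p q : Params} {x y : ℝ}

theorem commute_prodZ (D : SectorDecomp N δ p q x y) :
    Commute (sectorProj N δ) (Block.prodZ D.L) :=
  sectorProj_commute <| commute_prod_map _ fun X _ =>
    (commute_evenAlg_of_anticomm X.z_mem fun b i _ => majMode_anticomm_parity δ b i).symm

theorem commute_prodS (D : SectorDecomp N δ p q x y) :
    Commute (sectorProj N δ) (Block.prodS D.L) := by
  rw [← Block.prodZ_mul_self D.indep]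
  exact D.commute_prodZ.mul_right D.commute_prodZ

/-- The operator is the square of the Hermitian `sectorProj N δ * prodZ D.L`; the roots `z` are
carried in the blocks for this purpose. -/
theorem posSemidef (D : SectorDecomp N δ p q x y) :
    (sectorProj N δ * Block.prodS D.L).PosSemidef := by
  have hc := D.commute_prodZ
  refine posSemidef_of_sq (S := sectorProj N δ * Block.prodZ D.L) ?_ ?_
  · rw [Matrix.IsHermitian, Matrix.conjTranspose_mul, (Block.prodZ_isHermitian D.indep).eq,
      (sectorProj_isHermitian δ).eq, hc.eq]
  · rw [mul_assoc, ← mul_assoc (Block.prodZ D.L), ← hc.eq, mul_assoc, ← mul_assoc,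
      sectorProj_mul_self, Block.prodZ_mul_self D.indep]

/-- The projection is moved leftwards through the three exponentials, replacing `H` by the sector
Hamiltonian in each, and is then returned to the right. -/
theorem sandwich_mul_sectorProj (hN : 2 ≤ N) (D : SectorDecomp N δ p q x y) :
    NormedSpace.exp ((-(p.β / 2) : ℂ) • hamiltonian N p.γ p.g) * gibbsWeight N q *
        NormedSpace.exp ((-(p.β / 2) : ℂ) • hamiltonian N p.γ p.g) * sectorProj N δ =
      Block.prodS D.L * Block.prodS D.L * sectorProj N δ := by
  have hc : ∀ (c : ℂ) (γ g : ℝ), Commute (sectorProj N δ) (c • sectorH N δ γ g) := fun c γ g =>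
    sectorProj_commute ((sectorH_commute_parity δ γ g).smul_right c)
  have he : ∀ (c : ℂ) (γ g : ℝ), NormedSpace.exp (c • hamiltonian N γ g) * sectorProj N δ =
      NormedSpace.exp (c • sectorH N δ γ g) * sectorProj N δ := fun c γ g =>
    exp_mul_eq_of_mul_eq
      (by rw [smul_mul_assoc, hamiltonian_mul_sectorProj hN, smul_mul_assoc]) (hc c γ g)
  rw [gibbsWeight, ← neg_smul, mul_assoc, he, ← (commute_exp_right (hc _ _ _)).eq, mul_assoc,
    ← mul_assoc _ (sectorProj N δ), he, ← (commute_exp_right (hc _ _ _)).eq, ← mul_assoc,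
    ← mul_assoc, he, ← Block.exp_sandwich D.indep, D.sum_hp, D.sum_hq]
  rw [mul_assoc, mul_assoc, (((commute_exp_right (hc _ _ _))).mul_right
    (commute_exp_right (hc _ _ _))).eq]
  simp only [mul_assoc]

theorem trace_sectorProj_mul_prodS (D : SectorDecomp N δ p q x y) :
    (sectorProj N δ * Block.prodS D.L).trace = (1 / 2 : ℂ) * (x - (-1) ^ δ * y) := by
  rw [sectorProj, smul_mul_assoc, sub_mul, smul_mul_assoc, one_mul, Matrix.trace_smul,
    Matrix.trace_sub, Matrix.trace_smul, D.trace_prodS, D.trace_parity_prodS, smul_eq_mul,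
    smul_eq_mul]

end SectorDecomp

theorem sq_add_of_orthogonal {A : Type*} [Ring A] {E F S T M : A} (hE : E * E = E)
    (hF : F * F = F) (hEF : E * F = 0) (hFE : F * E = 0) (hadd : E + F = 1) (hS : Commute E S)
    (hT : Commute F T) (h₁ : M * E = S * S * E) (h₂ : M * F = T * T * F) :
    (E * S + F * T) * (E * S + F * T) = M := by
  have e1 : E * S * (E * S) = M * E := by
    rw [h₁, hS.eq, mul_assoc S E, ← mul_assoc E S, hS.eq, mul_assoc S E E, hE, mul_assoc S S]
  have e2 : F * T * (F * T) = M * F := by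
    rw [h₂, hT.eq, mul_assoc T F, ← mul_assoc F T, hT.eq, mul_assoc T F F, hF, mul_assoc T T]
  have e3 : E * S * (F * T) = 0 := by
    rw [hS.eq, mul_assoc, ← mul_assoc E, hEF, zero_mul, mul_zero]
  have e4 : F * T * (E * S) = 0 := by
    rw [hT.eq, mul_assoc, ← mul_assoc F, hFE, zero_mul, mul_zero]
  rw [add_mul, mul_add, mul_add, e1, e2, e3, e4, add_zero, zero_add, ← mul_add, hadd, mul_one]

theorem gibbsRoot [NeZero N] (hN : 2 ≤ N) (p : Params) :
    (NormedSpace.exp ((-(p.β / 2) : ℂ) • hamiltonian N p.γ p.g)).PosSemidef ∧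
      NormedSpace.exp ((-(p.β / 2) : ℂ) • hamiltonian N p.γ p.g) *
        NormedSpace.exp ((-(p.β / 2) : ℂ) • hamiltonian N p.γ p.g) = gibbsWeight N p := by
  constructor
  · have := exp_posSemidef (real_smul_isHermitian (hamiltonian_isHermitian hN p.γ p.g) (-(p.β / 2)))
    push_cast at this
    exact this
  · rw [gibbsWeight, ← exp_half_mul_self (-((p.β : ℂ) • hamiltonian N p.γ p.g)),
      show (1 / 2 : ℂ) • -((p.β : ℂ) • hamiltonian N p.γ p.g) =
        (-(p.β / 2) : ℂ) • hamiltonian N p.γ p.g by module]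

theorem gibbsWeight_posDef [NeZero N] (hN : 2 ≤ N) (p : Params) : (gibbsWeight N p).PosDef := by
  have := exp_posDef (real_smul_isHermitian (hamiltonian_isHermitian hN p.γ p.g) (-p.β))
  push_cast at this
  rwa [gibbsWeight, ← neg_smul]

theorem exists_fidelityOp [NeZero N] (hN : 2 ≤ N) {p q : Params} {x₁ y₁ x₀ y₀ : ℝ}
    (D₁ : SectorDecomp N 1 p q x₁ y₁) (D₀ : SectorDecomp N 0 p q x₀ y₀) :
    ∃ S : Op N, S.PosSemidef ∧
      S * S = NormedSpace.exp ((-(p.β / 2) : ℂ) • hamiltonian N p.γ p.g) * gibbsWeight N q *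
        NormedSpace.exp ((-(p.β / 2) : ℂ) • hamiltonian N p.γ p.g) ∧
      (((1 / 2 : ℂ) • (1 + parity N)) * S).trace = (1 / 2 : ℂ) * (x₁ + y₁) ∧
      (((1 / 2 : ℂ) • (1 - parity N)) * S).trace = (1 / 2 : ℂ) * (x₀ - y₀) := by
  -- Each sector has its own modes, so the two local products are different operators, valid only on
  -- their own sector; the projections glue them.
  refine ⟨sectorProj N 1 * Block.prodS D₁.L + sectorProj N 0 * Block.prodS D₀.L,
    D₁.posSemidef.add D₀.posSemidef, ?_, ?_, ?_⟩
  · exact sq_add_of_orthogonal (sectorProj_mul_self 1) (sectorProj_mul_self 0)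
      sectorProj_one_mul_zero sectorProj_zero_mul_one sectorProj_add D₁.commute_prodS
      D₀.commute_prodS (D₁.sandwich_mul_sectorProj hN) (D₀.sandwich_mul_sectorProj hN)
  · rw [← sectorProj_one, mul_add, ← mul_assoc, ← mul_assoc, sectorProj_mul_self,
      sectorProj_one_mul_zero, zero_mul, add_zero, D₁.trace_sectorProj_mul_prodS]
    ring
  · rw [← sectorProj_zero, mul_add, ← mul_assoc, ← mul_assoc, sectorProj_mul_self,
      sectorProj_zero_mul_one, zero_mul, zero_add, D₀.trace_sectorProj_mul_prodS]
    ring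

end Fidelity

/-! ### The partition function and the explicit formulas -/

section Partition

variable {N : ℕ} [NeZero N]

theorem kPlus_pos {k : ℝ} (hk : k ∈ kPlus N) : 0 < k := by
  obtain ⟨j, -, rfl⟩ := Finset.mem_image.mp hk
  have := Nat.pos_of_ne_zero (NeZero.ne N)
  positivity

theorem kPlus_lt_pi {k : ℝ} (hk : k ∈ kPlus N) : k < Real.pi := by
  obtain ⟨j, hj, rfl⟩ := Finset.mem_image.mp hk
  have hj := Finset.mem_range.mp hj
  have h : (2 * (j : ℝ) + 1) < N := by exact_mod_cast (by omega : 2 * j + 1 < N)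
  rw [div_lt_iff₀ (Nat.cast_pos.mpr (Nat.pos_of_ne_zero (NeZero.ne N))), mul_comm Real.pi]
  exact mul_lt_mul_of_pos_right h Real.pi_pos

theorem kMinus_pos {k : ℝ} (hk : k ∈ kMinus N) : 0 < k := by
  obtain ⟨j, hj, rfl⟩ := Finset.mem_image.mp hk
  have hj : (0 : ℝ) < j := Nat.cast_pos.mpr (Finset.mem_Ico.mp hj).1
  have := Nat.pos_of_ne_zero (NeZero.ne N)
  positivity

theorem kMinus_lt_pi {k : ℝ} (hk : k ∈ kMinus N) : k < Real.pi := by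
  obtain ⟨j, hj, rfl⟩ := Finset.mem_image.mp hk
  have hj := (Finset.mem_Ico.mp hj).2
  have h : (2 * (j : ℝ)) < N := by exact_mod_cast (by omega : 2 * j < N)
  rw [div_lt_iff₀ (Nat.cast_pos.mpr (Nat.pos_of_ne_zero (NeZero.ne N))), mul_comm Real.pi]
  exact mul_lt_mul_of_pos_right h Real.pi_pos

/-- Positivity makes `s` and `-s` disjoint, so each momentum is counted twice and nothing is merged
in the union. -/
theorem prod_union_neg {s : Finset ℝ} (hs : ∀ k ∈ s, 0 < k) {f : ℝ → ℝ}
    (hf : ∀ k ∈ s, f (-k) = f k) : ∏ k ∈ s ∪ s.image fun k => -k, f k = ∏ k ∈ s, f k ^ 2 := by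
  rw [Finset.prod_union, Finset.prod_image neg_injective.injOn, ← Finset.prod_mul_distrib]
  · exact Finset.prod_congr rfl fun k hk => by rw [hf k hk, sq]
  · rw [Finset.disjoint_left]
    intro k hk hk'
    obtain ⟨l, hl, rfl⟩ := Finset.mem_image.mp hk'
    linarith [hs _ hk, hs _ hl]

theorem energy_neg (γ g : ℝ) {k : ℝ} (h0 : 0 < k) (hpi : k < Real.pi) :
    energy γ g (-k) = energy γ g k := by
  have h1 : -k ≠ Real.pi := by linarith [Real.pi_pos]
  rw [energy, energy, if_neg (neg_ne_zero.mpr h0.ne'), if_neg h1, if_neg h0.ne', if_neg hpi.ne,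
    Real.cos_neg, Real.sin_neg]
  congr 2
  ring

theorem prod_KPlus (p : Params) (f : ℝ → ℝ) :
    ∏ k ∈ KPlus N, f (energy p.γ p.g k) = ∏ k ∈ kPlus N, f (energy p.γ p.g k) ^ 2 :=
  prod_union_neg (fun _ => kPlus_pos) fun k hk => by
    rw [energy_neg _ _ (kPlus_pos hk) (kPlus_lt_pi hk)]

theorem prod_KMinus (p : Params) (f : ℝ → ℝ) :
    ∏ k ∈ KMinus N, f (energy p.γ p.g k) = f (energy p.γ p.g 0) * f (energy p.γ p.g Real.pi) *
      ∏ k ∈ kMinus N, f (energy p.γ p.g k) ^ 2 := by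
  rw [KMinus, Finset.prod_union, Finset.prod_pair Real.pi_ne_zero.symm, mul_comm]
  · congr 1
    exact prod_union_neg (f := fun k => f (energy p.γ p.g k)) (fun _ => kMinus_pos) fun k hk => by
      rw [energy_neg _ _ (kMinus_pos hk) (kMinus_lt_pi hk)]
  · rw [Finset.disjoint_left]
    intro k hk hk'
    rw [Finset.mem_insert, Finset.mem_singleton] at hk'
    rcases Finset.mem_union.mp hk with h | h
    · rcases hk' with rfl | rfl
      exacts [(kMinus_pos h).ne' rfl, (kMinus_lt_pi h).ne rfl]
    · obtain ⟨l, hl, rfl⟩ := Finset.mem_image.mp h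
      have := kMinus_pos hl
      rcases hk' with h | h <;> linarith [Real.pi_pos]

theorem sqrt_uv_self (p : Params) (θ : ℝ → ℝ) (k : ℝ) :
    √(u p p θ θ k ^ 2 + v p p θ θ k ^ 2) = 2 * Real.cosh (2 * (p.β * energy p.γ p.g k)) := by
  rw [u, v, sub_self (θ k), zero_div, Real.cos_zero, Real.sin_zero, mul_zero, mul_one,
    zero_pow two_ne_zero, add_zero, ← two_mul]
  exact Real.sqrt_sq (by have := Real.cosh_pos (2 * (p.β * energy p.γ p.g k)); positivity)

/-- For equal states `√(u² + v²) = 2 cosh(2βε)`, and adding or subtracting `2` gives `(2 cosh βε)²`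
or `(2 sinh βε)²`: the factors of `k` and `-k` together. -/
theorem explicit_self_eq_partitionZ (p : Params) (θ : ℝ → ℝ) :
    explicitPlus N p p θ θ + explicitMinus N p p θ θ = partitionZ N p := by
  have hc : ∀ k, √(u p p θ θ k ^ 2 + v p p θ θ k ^ 2) + 2 =
      (2 * Real.cosh (p.β * energy p.γ p.g k)) ^ 2 := fun k => by
    rw [sqrt_uv_self, Real.cosh_two_mul, Real.sinh_sq]; ring
  have hs : ∀ k, √(u p p θ θ k ^ 2 + v p p θ θ k ^ 2) - 2 =
      (2 * Real.sinh (p.β * energy p.γ p.g k)) ^ 2 := fun k => by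
    rw [sqrt_uv_self, Real.cosh_two_mul, Real.cosh_sq]; ring
  rw [explicitPlus, explicitMinus, partitionZ,
    prod_KPlus p fun x => 2 * Real.cosh (p.β * x), prod_KPlus p fun x => 2 * Real.sinh (p.β * x),
    prod_KMinus p fun x => 2 * Real.cosh (p.β * x), prod_KMinus p fun x => 2 * Real.sinh (p.β * x)]
  simp only [hc, hs, add_self_div_two]
  ring

theorem fidelityPlus_fidelityMinus_gibbsWeight (hN : Even N) (p q : Params) (θ η : ℝ → ℝ)
    (hθ : ∀ k ∈ kPlus N ∪ kMinus N, IsBogoliubovAngle p.γ p.g k (θ k))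
    (hη : ∀ k ∈ kPlus N ∪ kMinus N, IsBogoliubovAngle q.γ q.g k (η k)) :
    fidelityPlus (gibbsWeight N p) (gibbsWeight N q) = (explicitPlus N p q θ η : ℂ) ∧
      fidelityMinus (gibbsWeight N p) (gibbsWeight N q) = (explicitMinus N p q θ η : ℂ) ∧
      ∀ a b : ℝ, 0 < a → 0 < b →
        fidelity ((a : ℂ)⁻¹ • gibbsWeight N p) ((b : ℂ)⁻¹ • gibbsWeight N q) =
          fidelity (gibbsWeight N p) (gibbsWeight N q) / ((√(a * b) : ℝ) : ℂ) := by
  have hN2 : 2 ≤ N := by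
    obtain ⟨M, hM⟩ := hN
    have := NeZero.ne N
    omega
  obtain ⟨D₁⟩ := exists_sectorDecomp_plus hN p q θ η
    (fun k hk => hθ k (Finset.mem_union_left _ hk)) fun k hk => hη k (Finset.mem_union_left _ hk)
  obtain ⟨D₀⟩ := exists_sectorDecomp_minus hN p q θ η
    (fun k hk => hθ k (Finset.mem_union_right _ hk)) fun k hk => hη k (Finset.mem_union_right _ hk)
  obtain ⟨S, hS, hSS, h₁, h₀⟩ := exists_fidelityOp hN2 D₁ D₀
  obtain ⟨hR, hRR⟩ := gibbsRoot hN2 p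
  have hF := fidelityOp_eq hR hRR hS hSS
  refine ⟨?_, ?_, fun a b ha hb => ?_⟩
  · rw [fidelityPlus, hF, h₁, explicitPlus]
    push_cast
    rfl
  · rw [fidelityMinus, hF, h₀, explicitMinus]
    push_cast
    rfl
  · rw [fidelity, fidelity, hF, fidelityOp_smul hR hRR hS hSS ha hb, Matrix.trace_smul,
      smul_eq_mul, mul_comm, div_eq_mul_inv]

-- The root of `√A A √A` is `A`, so the fidelity formula at equal parameters computes the trace.
-- Positivity comes from the positive definiteness of the exponential rather than from the explicit
-- products.
open scoped ComplexOrder in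
theorem trace_gibbsWeight (hN : Even N) (p : Params) (θ : ℝ → ℝ)
    (hθ : ∀ k ∈ kPlus N ∪ kMinus N, IsBogoliubovAngle p.γ p.g k (θ k)) :
    (gibbsWeight N p).trace = (partitionZ N p : ℂ) ∧ 0 < partitionZ N p := by
  have hN2 : 2 ≤ N := by
    obtain ⟨M, hM⟩ := hN
    have := NeZero.ne N
    omega
  obtain ⟨h₁, h₀, -⟩ := fidelityPlus_fidelityMinus_gibbsWeight hN p p θ θ hθ hθ
  obtain ⟨hR, hRR⟩ := gibbsRoot hN2 p
  have hA := gibbsWeight_posDef hN2 p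
  have hAA : fidelityOp (gibbsWeight N p) (gibbsWeight N p) = gibbsWeight N p := by
    refine fidelityOp_eq hR hRR hA.posSemidef ?_
    rw [← hRR]
    simp only [mul_assoc]
  have htr : (gibbsWeight N p).trace = (partitionZ N p : ℂ) := by
    rw [← explicit_self_eq_partitionZ p θ, Complex.ofReal_add, ← h₁, ← h₀,
      fidelityPlus_add_fidelityMinus, fidelity, hAA]
  refine ⟨htr, ?_⟩
  have := hA.trace_pos
  rwa [htr, Complex.zero_lt_real] at this

end Partition

end XYChain

/-! ### The fidelity of two Gibbs states -/

theorem mainTheorem1 (N : ℕ) [NeZero N] (hN : Even N) (p q : XYChain.Params)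
    (θ η : ℝ → ℝ)
    (hθ : ∀ k ∈ XYChain.kPlus N ∪ XYChain.kMinus N, XYChain.IsBogoliubovAngle p.γ p.g k (θ k))
    (hη : ∀ k ∈ XYChain.kPlus N ∪ XYChain.kMinus N, XYChain.IsBogoliubovAngle q.γ q.g k (η k)) :
    XYChain.fidelity (XYChain.gibbsState N p) (XYChain.gibbsState N q) =
        (XYChain.fidelityPlus (XYChain.gibbsWeight N p) (XYChain.gibbsWeight N q) +
            XYChain.fidelityMinus (XYChain.gibbsWeight N p) (XYChain.gibbsWeight N q)) /
          ((√(XYChain.partitionZ N p * XYChain.partitionZ N q) : ℝ) : ℂ) ∧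
      XYChain.fidelityPlus (XYChain.gibbsWeight N p) (XYChain.gibbsWeight N q) =
        (XYChain.explicitPlus N p q θ η : ℂ) ∧
      XYChain.fidelityMinus (XYChain.gibbsWeight N p) (XYChain.gibbsWeight N q) =
        (XYChain.explicitMinus N p q θ η : ℂ) ∧
      (XYChain.gibbsWeight N p).trace = (XYChain.partitionZ N p : ℂ) ∧
      (XYChain.gibbsWeight N q).trace = (XYChain.partitionZ N q : ℂ) ∧
      0 < XYChain.partitionZ N p ∧ 0 < XYChain.partitionZ N q := by
  obtain ⟨hp, hp0⟩ := XYChain.trace_gibbsWeight hN p θ hθ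
  obtain ⟨hq, hq0⟩ := XYChain.trace_gibbsWeight hN q η hη
  obtain ⟨h₁, h₀, h⟩ := XYChain.fidelityPlus_fidelityMinus_gibbsWeight hN p q θ η hθ hη
  refine ⟨?_, h₁, h₀, hp, hq, hp0, hq0⟩
  rw [XYChain.gibbsState, XYChain.gibbsState, hp, hq, h _ _ hp0 hq0,
    XYChain.fidelityPlus_add_fidelityMinus]
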